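/- Let $K$ be an algebraically closed field of characteristic $p>3$ and let $W$ be the restricted Witt algebra over $K$: it has basis $e_{-1},e_0,\dots,e_{p-2}$, Lie bracket $[e_i,e_j]=(j-i)e_{i+j}$ (where $e_k=0$ for $k\notin\{-1,\dots,p-2\}$), and $p$-map given by $e_0^{[p]}=e_0$ and $e_i^{[p]}=0$ for $i\neq 0$. For $-1\le i\le p-1$ put $W_i=Ke_i\oplus\cdots\oplus Ke_{p-2}$. For $\chi\in W^*$ let the height be $r(\chi)=\min\{i\mid -1\le i\le p-1,\ \chi|_{W_i}=0\}$, and let $U_\chi(W)$ and $U_\chi(W_0)$ be the reduced enveloping algebras (the quotients of the enveloping algebras by the relations $x^p-x^{[p]}=\chi(x)^p$). Assume $r(\chi)\le 1$ and put $\Lambda(\chi)=\{\lambda\in K\mid \lambda^p-\lambda=\chi(e_0)^p\}$. For $\lambda\in\Lambda(\chi)$ let $K_\lambda$ be the one-dimensional $U_\chi(W_0)$-module $K$ with $e_0\cdot 1=\lambda$ and $e_i\cdot 1=0$ for $i\ge 1$, and let $V_\chi(\lambda)=U_\chi(W)\otimes_{U_\chi(W_0)}K_\lambda$. For $\lambda,\lambda'\in\Lambda(\chi)$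 we have $\lambda-\lambda'\in\mathbb F_p$; let $[\lambda-\lambda']\in\{0,1,\dots,p-1\}$ be its representative. Let $$\Theta(\chi)=\bigl(\{(0,p-1),(p-1,0)\}\cap(\Lambda(\chi)\times\Lambda(\chi))\bigr)\cup\{(\mu,\mu)\mid\mu\in\Lambda(\chi)\}.$$ Let $\lambda,\lambda'\in\Lambda(\chi)$ with $(\lambda,\lambda')\notin\Theta(\chi)$ and $\lambda+\lambda'\neq p-1$ in $K$. Then, as $K$-vector spaces, $$\operatorname{Ext}^1_{U_\chi(W_0)}(K_{\lambda'},V_\chi(\lambda))\simeq\begin{cases} K,&\text{if }[\lambda-\lambda']=1\text{ and }\lambda\in\{1,p-1\},\\ K,&\text{if }[\lambda-\lambda']\in\{2,3\},\\ K,&\text{if }[\lambda-\lambda']=4\text{ and }p>5,\\ K,&\text{if }[\lambda-\lambda']=4\text{ and }\lambda\in\{0,3\},\\ K,&\text{if }[\lambda-\lambda']=5\text{ and }\lambda\in\{0,4\},\\ K,&\text{if }[\lambda-\lambda']=6,\ 2\lambda=5\pm\sqrt{19}\text{ and }p>7,\\ 0,&\text{otherwise,} \end{cases}$$ where $\pm\sqrt{19}$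 denote the roots of $x^2-19$ in $K$. -/

import Mathlib

open scoped TensorProduct ModuleCat

universe u v w

/-- The underlying `K`-space of the Witt algebra. A vector is the family of its coordinates in
the basis `e_{-1}, …, e_{p-2}`; the index `k : Fin p` belongs to the basis vector `e_{k-1}`. -/
def Witt (K : Type u) (p : ℕ) : Type u := Fin p → K

namespace Witt

/-- The degree of the basis vector with index `k`, an integer between `-1` and `p - 2`. -/
def deg {p : ℕ} (k : Fin p) : ℤ := (k : ℤ) - 1

variable {K : Type u} [Field K] {p : ℕ}

instance : AddCommGroup (Witt K p) := inferInstanceAs (AddCommGroup (Fin p → K))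

instance : Module K (Witt K p) := inferInstanceAs (Module K (Fin p → K))

/-- The basis vector `e_i` for `-1 ≤ i ≤ p - 2`; by convention `e_i = 0` for all other `i`. -/
def e (K : Type u) [Field K] (p : ℕ) (i : ℤ) : Witt K p := fun k => if deg k = i then 1 else 0

/-- The coefficient of `e_k` in `[e_a, e_b] = (b - a) e_{a+b}` (all indices being degrees). -/
def structureConst (K : Type u) [Field K] {p : ℕ} (a b k : Fin p) : K :=
  if deg a + deg b = deg k then ((deg b - deg a : ℤ) : K) else 0

/-- The bilinear bracket with `[e_i, e_j] = (j - i) e_{i+j}`. -/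
instance : Bracket (Witt K p) (Witt K p) where
  bracket x y := fun k => ∑ a, ∑ b, structureConst K a b k * (x a * y b)

theorem bracket_apply (x y : Witt K p) (k : Fin p) :
    ⁅x, y⁆ k = ∑ a, ∑ b, structureConst K a b k * (x a * y b) := rfl

@[simp] theorem add_apply (x y : Witt K p) (k : Fin p) : (x + y) k = x k + y k := rfl

@[simp] theorem zero_apply (k : Fin p) : (0 : Witt K p) k = 0 := rfl

@[simp] theorem smul_apply (c : K) (x : Witt K p) (k : Fin p) : (c • x) k = c * x k := rfl

theorem structureConst_swap (a b k : Fin p) :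
    structureConst K a b k = -structureConst K b a k := by
  unfold structureConst
  by_cases h : deg a + deg b = deg k
  · rw [if_pos h, if_pos (by rw [add_comm]; exact h)]; push_cast; ring
  · rw [if_neg h, if_neg (by rw [add_comm]; exact h)]; ring

theorem sum_structureConst [CharP K p] (a b c m : Fin p) :
    ∑ k, structureConst K b c k * structureConst K a k m =
      if deg a + deg b + deg c = deg m then
        ((deg b + deg c - deg a : ℤ) : K) * ((deg c - deg b : ℤ) : K) else 0 := by
  unfold structureConst
  have ha := a.isLt
  have hb := b.isLt
  have hc := c.isLt
  have hm := m.isLt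
  by_cases hk : ∃ k : Fin p, deg b + deg c = deg k
  · obtain ⟨k, hk⟩ := hk
    rw [Finset.sum_eq_single k]
    · rw [if_pos hk, ← hk, ← add_assoc]
      split_ifs <;> ring
    · intro k' _ hne
      rw [if_neg, zero_mul]
      intro h
      apply hne
      unfold deg at h hk
      ext
      omega
    · intro h; exact absurd (Finset.mem_univ k) h
  · rw [Finset.sum_eq_zero]
    · split_ifs with h
      · by_cases hbc : (b : ℕ) = 0 ∧ (c : ℕ) = 0
        · have : deg c - deg b = 0 := by unfold deg; omega
          rw [this]; simp
        · have hge : (p : ℤ) ≤ b + c - 1 := by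
            by_contra hlt
            apply hk
            refine ⟨⟨(b : ℕ) + c - 1, by omega⟩, ?_⟩
            unfold deg
            push_cast
            omega
          have : deg b + deg c - deg a = p := by
            unfold deg at h ⊢
            omega
          rw [this]; simp
      · rfl
    · intro k _
      rw [if_neg (fun h => hk ⟨k, h⟩), zero_mul]

theorem bracket_bracket [CharP K p] (x y z : Witt K p) (m : Fin p) :
    ⁅x, ⁅y, z⁆⁆ m = ∑ a, ∑ b, ∑ c,
      (if deg a + deg b + deg c = deg m then
        ((deg b + deg c - deg a : ℤ) : K) * ((deg c - deg b : ℤ) : K) else 0) *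
        (x a * y b * z c) := by
  simp only [bracket_apply, ← sum_structureConst]
  refine Finset.sum_congr rfl fun a _ => ?_
  simp only [Finset.mul_sum, Finset.sum_mul]
  rw [Finset.sum_comm]
  refine Finset.sum_congr rfl fun b _ => ?_
  rw [Finset.sum_comm]
  refine Finset.sum_congr rfl fun c _ => Finset.sum_congr rfl fun k _ => ?_
  ring

theorem bracket_swap (x y : Witt K p) : ⁅x, y⁆ = -⁅y, x⁆ := by
  funext k
  change _ = -(⁅y, x⁆ k)
  simp only [bracket_apply]
  rw [Finset.sum_comm, ← Finset.sum_neg_distrib]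
  refine Finset.sum_congr rfl fun b _ => ?_
  rw [← Finset.sum_neg_distrib]
  refine Finset.sum_congr rfl fun a _ => ?_
  rw [structureConst_swap a b k]
  ring

theorem bracket_self (x : Witt K p) : ⁅x, x⁆ = 0 := by
  funext k
  simp only [bracket_apply, zero_apply]
  rw [← Fintype.sum_prod_type']
  refine Finset.sum_involution (fun q _ => (q.2, q.1)) ?_ ?_ ?_ ?_
  · rintro ⟨a, b⟩ _
    simp only
    rw [structureConst_swap a b k]
    ring
  · rintro ⟨a, b⟩ _ h heq
    simp only [Prod.mk.injEq] at heq
    apply h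
    simp only [heq.1]
    simp [structureConst]
  · intros; exact Finset.mem_univ _
  · rintro ⟨a, b⟩ _; rfl

instance [CharP K p] : LieRing (Witt K p) where
  add_lie x y z := by
    funext k
    simp only [bracket_apply, add_apply, add_mul, mul_add, Finset.sum_add_distrib]
  lie_add x y z := by
    funext k
    simp only [bracket_apply, add_apply, mul_add, Finset.sum_add_distrib]
  lie_self := bracket_self
  leibniz_lie x y z := by
    have hswap : ⁅⁅x, y⁆, z⁆ = -⁅z, ⁅x, y⁆⁆ := bracket_swap _ _
    rw [hswap]
    funext m
    change _ = -(⁅z, ⁅x, y⁆⁆ m) + ⁅y, ⁅x, z⁆⁆ m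
    have h1 : ⁅z, ⁅x, y⁆⁆ m = ∑ a, ∑ b, ∑ c,
        (if deg c + deg a + deg b = deg m then
          ((deg a + deg b - deg c : ℤ) : K) * ((deg b - deg a : ℤ) : K) else 0) *
          (z c * x a * y b) := by
      rw [bracket_bracket, Finset.sum_comm]
      exact Finset.sum_congr rfl fun a _ => Finset.sum_comm
    have h2 : ⁅y, ⁅x, z⁆⁆ m = ∑ a, ∑ b, ∑ c,
        (if deg b + deg a + deg c = deg m then
          ((deg a + deg c - deg b : ℤ) : K) * ((deg c - deg a : ℤ) : K) else 0) *
          (y b * x a * z c) := by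
      rw [bracket_bracket, Finset.sum_comm]
    rw [h1, h2, bracket_bracket]
    simp only [← Finset.sum_neg_distrib, ← Finset.sum_add_distrib]
    refine Finset.sum_congr rfl fun a _ => Finset.sum_congr rfl fun b _ =>
      Finset.sum_congr rfl fun c _ => ?_
    have e1 : deg c + deg a + deg b = deg a + deg b + deg c := by ring
    have e2 : deg b + deg a + deg c = deg a + deg b + deg c := by ring
    rw [e1, e2]
    split_ifs
    · push_cast; ring
    · ring

instance [CharP K p] : LieAlgebra K (Witt K p) where
  lie_smul t x y := by
    funext k
    simp only [bracket_apply, smul_apply, Finset.mul_sum]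
    refine Finset.sum_congr rfl fun a _ => Finset.sum_congr rfl fun b _ => ?_
    ring

theorem e_bracket_e {i j : ℤ} (hi : -1 ≤ i) (hi' : i ≤ (p : ℤ) - 2) (hj : -1 ≤ j)
    (hj' : j ≤ (p : ℤ) - 2) : ⁅e K p i, e K p j⁆ = ((j - i : ℤ) : K) • e K p (i + j) := by
  obtain ⟨a, ha⟩ : ∃ a : Fin p, deg a = i :=
    ⟨⟨(i + 1).toNat, by omega⟩, by unfold deg; simp only; omega⟩
  obtain ⟨b, hb⟩ : ∃ b : Fin p, deg b = j :=
    ⟨⟨(j + 1).toNat, by omega⟩, by unfold deg; simp only; omega⟩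
  have hinj : ∀ c d : Fin p, deg c = deg d → c = d := by
    intro c d h
    unfold deg at h
    ext
    omega
  funext k
  rw [bracket_apply, Finset.sum_eq_single a, Finset.sum_eq_single b]
  · subst ha; subst hb
    by_cases h : deg a + deg b = deg k
    · simp [e, structureConst, h]
    · simp [e, structureConst, h, Ne.symm h]
  · intro c _ hc
    have : ¬ deg c = j := fun h => hc (hinj _ _ (h.trans hb.symm))
    simp [e, this]
  · intro h; exact absurd (Finset.mem_univ _) h
  · intro c _ hc
    have : ¬ deg c = i := fun h => hc (hinj _ _ (h.trans ha.symm))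
    simp [e, this]
  · intro h; exact absurd (Finset.mem_univ _) h

/-- The subspace `W_i = K e_i ⊕ ⋯ ⊕ K e_{p-2}`. -/
def filtration (K : Type u) [Field K] (p : ℕ) (i : ℤ) : Submodule K (Witt K p) where
  carrier := {x | ∀ k : Fin p, deg k < i → x k = 0}
  add_mem' hx hy k hk := by rw [add_apply, hx k hk, hy k hk, add_zero]
  zero_mem' _ _ := rfl
  smul_mem' c x hx k hk := by rw [smul_apply, hx k hk, mul_zero]

theorem e_mem_filtration {i j : ℤ} (h : i ≤ j) : e K p j ∈ filtration K p i := by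
  intro k hk
  exact if_neg (by omega)

/-- The subalgebra `W_0 = K e_0 ⊕ ⋯ ⊕ K e_{p-2}`. -/
def W0 (K : Type u) [Field K] (p : ℕ) [CharP K p] : LieSubalgebra K (Witt K p) where
  toSubmodule := filtration K p 0
  lie_mem' := by
    intro x y hx hy k hk
    rw [bracket_apply]
    refine Finset.sum_eq_zero fun a _ => Finset.sum_eq_zero fun b _ => ?_
    unfold structureConst
    split_ifs with h
    · by_cases ha : deg a < 0
      · rw [hx a ha]; ring
      · rw [hy b (by omega)]; ring
    · ring

/-- The height `r(χ) = min {i | -1 ≤ i ≤ p - 1, χ vanishes on W_i}`. -/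
noncomputable def height (χ : Module.Dual K (Witt K p)) : ℤ :=
  sInf {i : ℤ | -1 ≤ i ∧ i ≤ (p : ℤ) - 1 ∧ ∀ x ∈ filtration K p i, χ x = 0}

theorem apply_e_eq_zero_of_height_le {χ : Module.Dual K (Witt K p)} {h i : ℤ}
    (hχ : height χ ≤ h) (hi : h ≤ i) : χ (e K p i) = 0 := by
  have hmem := Int.csInf_mem
    (s := {i : ℤ | -1 ≤ i ∧ i ≤ (p : ℤ) - 1 ∧ ∀ x ∈ filtration K p i, χ x = 0})
    ⟨(p : ℤ) - 1, by omega, le_rfl, by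
      intro x hx
      have : x = 0 := by
        funext k
        refine hx k ?_
        have := k.isLt
        unfold deg
        omega
      rw [this, map_zero]⟩ ⟨-1, fun _ h => h.1⟩
  exact hmem.2.2 _ (e_mem_filtration (hχ.trans hi))

end Witt

section ReducedEnveloping

attribute [local instance] LieRing.ofAssociativeRing

variable {K : Type u} [Field K] {L : Type v} [LieRing L] [LieAlgebra K L]

/-- The relations `x ^ p = x^[p] + χ(x) ^ p` of a reduced enveloping algebra, for `x` in a basis
`b` of `L`, where `b'` is the family of the `p`-th powers `(b i)^[p]`.
(As `x ↦ x ^ p - x^[p]` is a `p`-semilinear map from a restricted Lie algebra to the centre of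
its enveloping algebra, the relations for a basis imply those for all `x`.) -/
inductive ReducedRel (p : ℕ) {I : Type w} (b b' : I → L) (χ : Module.Dual K L) :
    UniversalEnvelopingAlgebra K L → UniversalEnvelopingAlgebra K L → Prop
  | pow_eq (i : I) : ReducedRel p b b' χ (UniversalEnvelopingAlgebra.ι K (b i) ^ p)
      (UniversalEnvelopingAlgebra.ι K (b' i) + algebraMap K _ (χ (b i) ^ p))

/-- The reduced enveloping algebra `U_χ(L) = U(L) / (x ^ p - x^[p] - χ(x) ^ p)` of a restricted
Lie algebra `L` with basis `b` and `p`-map given by `(b i)^[p] = b' i`. -/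
abbrev ReducedEnveloping (p : ℕ) {I : Type w} (b b' : I → L) (χ : Module.Dual K L) :=
  RingQuot (ReducedRel p b b' χ)

/-- The canonical map `L → U_χ(L)`. -/
noncomputable def ReducedEnveloping.ι (p : ℕ) {I : Type w} (b b' : I → L)
    (χ : Module.Dual K L) : L →ₗ⁅K⁆ ReducedEnveloping p b b' χ :=
  (RingQuot.mkAlgHom K (ReducedRel p b b' χ) : _ →ₗ⁅K⁆ _).comp
    (UniversalEnvelopingAlgebra.ι K)

theorem ReducedEnveloping.ι_apply (p : ℕ) {I : Type w} (b b' : I → L)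
    (χ : Module.Dual K L) (x : L) : ReducedEnveloping.ι p b b' χ x =
      RingQuot.mkAlgHom K (ReducedRel p b b' χ) (UniversalEnvelopingAlgebra.ι K x) := rfl

theorem ReducedEnveloping.ι_pow (p : ℕ) {I : Type w} (b b' : I → L)
    (χ : Module.Dual K L) (i : I) : ReducedEnveloping.ι p b b' χ (b i) ^ p =
      ReducedEnveloping.ι p b b' χ (b' i) + algebraMap K _ (χ (b i) ^ p) := by
  have h := RingQuot.mkAlgHom_rel K (ReducedRel.pow_eq (p := p) (b := b) (b' := b') (χ := χ) i)
  rw [map_pow, map_add, AlgHom.commutes] at h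
  exact h

/-- The universal property of `U_χ(L)`: a Lie algebra homomorphism into an associative algebra
that respects the `p`-th power relations extends to `U_χ(L)`. -/
noncomputable def ReducedEnveloping.lift {p : ℕ} {I : Type w} {b b' : I → L}
    {χ : Module.Dual K L} {A : Type*} [Ring A] [Algebra K A] (f : L →ₗ⁅K⁆ A)
    (hf : ∀ i, f (b i) ^ p = f (b' i) + algebraMap K A (χ (b i) ^ p)) :
    ReducedEnveloping p b b' χ →ₐ[K] A :=
  RingQuot.liftAlgHom K ⟨UniversalEnvelopingAlgebra.lift K f, by
    rintro _ _ ⟨i⟩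
    rw [map_pow, map_add, AlgHom.commutes, UniversalEnvelopingAlgebra.lift_ι_apply,
      UniversalEnvelopingAlgebra.lift_ι_apply]
    exact hf i⟩

theorem ReducedEnveloping.lift_ι {p : ℕ} {I : Type w} {b b' : I → L}
    {χ : Module.Dual K L} {A : Type*} [Ring A] [Algebra K A] (f : L →ₗ⁅K⁆ A)
    (hf : ∀ i, f (b i) ^ p = f (b' i) + algebraMap K A (χ (b i) ^ p)) (x : L) :
    ReducedEnveloping.lift f hf (ReducedEnveloping.ι p b b' χ x) = f x := by
  rw [ReducedEnveloping.ι_apply, ReducedEnveloping.lift, RingQuot.liftAlgHom_mkAlgHom_apply,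
    UniversalEnvelopingAlgebra.lift_ι_apply]

end ReducedEnveloping

section Induction

variable {R S : Type u} [Ring R] [Ring S]

/-- The `S`-submodule of `S ⊗_ℤ M` generated by all `s f(r) ⊗ m - s ⊗ r m`. -/
def balancedRelations (f : R →+* S) (M : Type u) [AddCommGroup M] [Module R M] :
    Submodule S (S ⊗[ℤ] M) :=
  Submodule.span S {t | ∃ (s : S) (r : R) (m : M), t = (s * f r) ⊗ₜ[ℤ] m - s ⊗ₜ[ℤ] (r • m)}

/-- The induced `S`-module `S ⊗_R M`, where `S` is a right `R`-module through `f`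
(the rings need not be commutative). -/
abbrev InducedModule (f : R →+* S) (M : Type u) [AddCommGroup M] [Module R M] : Type u :=
  (S ⊗[ℤ] M) ⧸ balancedRelations f M

end Induction

namespace Witt

section Modules

attribute [local instance] LieRing.ofAssociativeRing

variable {K : Type u} [Field K] {p : ℕ} [CharP K p]

/-- The basis `e_{-1}, …, e_{p-2}` of `W`. -/
def basisW (K : Type u) [Field K] (p : ℕ) (i : {i : ℤ // -1 ≤ i ∧ i ≤ (p : ℤ) - 2}) :
    Witt K p := e K p i

/-- The `p`-th powers `e_i^[p] = δ_{i0} e_i`. -/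
def basisWpow (K : Type u) [Field K] (p : ℕ) (i : {i : ℤ // -1 ≤ i ∧ i ≤ (p : ℤ) - 2}) :
    Witt K p := if i.1 = 0 then e K p i else 0

/-- The basis `e_0, …, e_{p-2}` of `W_0`. -/
def basisW0 (K : Type u) [Field K] (p : ℕ) [CharP K p]
    (i : {i : ℤ // 0 ≤ i ∧ i ≤ (p : ℤ) - 2}) : W0 K p := ⟨e K p i, e_mem_filtration i.2.1⟩

/-- The `p`-th powers `e_i^[p] = δ_{i0} e_i` in `W_0`. -/
def basisW0pow (K : Type u) [Field K] (p : ℕ) [CharP K p]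
    (i : {i : ℤ // 0 ≤ i ∧ i ≤ (p : ℤ) - 2}) : W0 K p :=
  if i.1 = 0 then basisW0 K p i else 0

/-- The reduced enveloping algebra `U_χ(W)`. -/
abbrev UW (χ : Module.Dual K (Witt K p)) : Type u :=
  ReducedEnveloping p (basisW K p) (basisWpow K p) χ

/-- The restriction of `χ` to `W_0`. -/
def restrictW0 (χ : Module.Dual K (Witt K p)) : Module.Dual K (W0 K p) :=
  χ ∘ₗ (W0 K p).toSubmodule.subtype

/-- The reduced enveloping algebra `U_χ(W_0)`. -/
abbrev UW0 (χ : Module.Dual K (Witt K p)) : Type u :=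
  ReducedEnveloping p (basisW0 K p) (basisW0pow K p) (restrictW0 χ)

/-- The canonical homomorphism `U_χ(W_0) → U_χ(W)` that extends the inclusion of `W_0` in `W`. -/
noncomputable def UW0toUW (χ : Module.Dual K (Witt K p)) : UW0 χ →ₐ[K] UW χ :=
  ReducedEnveloping.lift
    (f := (ReducedEnveloping.ι p (basisW K p) (basisWpow K p) χ).comp (W0 K p).incl) (by
      intro i
      have h := ReducedEnveloping.ι_pow p (basisW K p) (basisWpow K p) χ
        ⟨i.1, by have := i.2.1; omega, i.2.2⟩
      have h' : ((basisW0pow K p i : W0 K p) : Witt K p) =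
          basisWpow K p ⟨i.1, by have := i.2.1; omega, i.2.2⟩ := by
        unfold basisW0pow basisWpow
        split_ifs <;> rfl
      rw [LieHom.comp_apply, LieHom.comp_apply, LieSubalgebra.coe_incl, h']
      exact h)

/-- The set of weights `Λ(χ) = {λ ∈ K | λ ^ p - λ = χ(e_0) ^ p}`. -/
def weights (χ : Module.Dual K (Witt K p)) : Set K :=
  {l | l ^ p - l = χ (e K p 0) ^ p}

/-- The coefficient of `e_i` in an element of `W`. -/
def coeff (i : ℤ) : Witt K p →ₗ[K] K where
  toFun x := ∑ k, if deg k = i then x k else 0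
  map_add' x y := by
    rw [← Finset.sum_add_distrib]
    refine Finset.sum_congr rfl fun k _ => ?_
    split_ifs <;> simp
  map_smul' c x := by
    rw [smul_eq_mul, Finset.mul_sum]
    refine Finset.sum_congr rfl fun k _ => ?_
    split_ifs <;> simp

theorem coeff_e {i j : ℤ} (hi : -1 ≤ i) (hi' : i ≤ (p : ℤ) - 2) :
    coeff i (e K p j) = if i = j then 1 else 0 := by
  change (∑ k : Fin p, if deg k = i then e K p j k else 0) = _
  rw [Finset.sum_eq_single ⟨(i + 1).toNat, by omega⟩]
  · have h : deg (⟨(i + 1).toNat, by omega⟩ : Fin p) = i := by unfold deg; simp only; omega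
    rw [if_pos h, e, h]
  · intro k _ hk
    refine if_neg fun h => hk ?_
    unfold deg at h
    ext
    simp only
    omega
  · intro h; exact absurd (Finset.mem_univ _) h

theorem coeff_zero_bracket (x y : W0 K p) : coeff 0 (⁅x, y⁆ : W0 K p).1 = 0 := by
  change (∑ k : Fin p, if deg k = 0 then (⁅x.1, y.1⁆ : Witt K p) k else 0) = 0
  refine Finset.sum_eq_zero fun k _ => ?_
  split_ifs with hk
  · change ⁅x.1, y.1⁆ k = 0
    rw [bracket_apply]
    refine Finset.sum_eq_zero fun a _ => Finset.sum_eq_zero fun b _ => ?_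
    unfold structureConst
    split_ifs with h
    · rcases lt_trichotomy (deg a) 0 with ha | ha | ha
      · rw [x.2 a ha]; ring
      · have : deg b - deg a = 0 := by omega
        rw [this]; simp
      · rw [y.2 b (by omega)]; ring
    · ring
  · rfl

/-- The Lie algebra homomorphism `W_0 → K` with `e_0 ↦ l` and `e_i ↦ 0` for `i ≠ 0`. -/
def characterW0 (K : Type u) [Field K] (p : ℕ) [CharP K p] (l : K) : W0 K p →ₗ⁅K⁆ K :=
  { l • (coeff 0 ∘ₗ (W0 K p).toSubmodule.subtype) with
    map_lie' := by
      intro x y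
      change l * coeff 0 (⁅x, y⁆ : W0 K p).1 = _
      rw [coeff_zero_bracket, mul_zero, LieRing.of_associative_ring_bracket, mul_comm, sub_self] }

theorem characterW0_apply (l : K) (x : W0 K p) :
    characterW0 K p l x = l * coeff 0 (x : Witt K p) := rfl

/-- For `χ` of height at most `1` and `l ∈ Λ(χ)`, the homomorphism `U_χ(W_0) → K` with
`e_0 ↦ l` and `e_i ↦ 0` for `i ≠ 0`. -/
noncomputable def characterUW0 [Fact p.Prime] (χ : Module.Dual K (Witt K p)) (hχ : height χ ≤ 1)
    (l : K) (hl : l ∈ weights χ) : UW0 χ →ₐ[K] K :=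
  ReducedEnveloping.lift (f := characterW0 K p l) (by
    have hp : p ≠ 0 := (Fact.out : p.Prime).ne_zero
    have hp2 : 2 ≤ p := (Fact.out : p.Prime).two_le
    rintro ⟨i, hi, hi'⟩
    have hl' : l ^ p - l = χ (e K p 0) ^ p := hl
    change (l * coeff 0 (e K p i)) ^ p =
      l * coeff 0 (basisW0pow K p ⟨i, hi, hi'⟩ : Witt K p) + χ (e K p i) ^ p
    by_cases h : i = 0
    · subst h
      have : ((basisW0pow K p ⟨0, hi, hi'⟩ : W0 K p) : Witt K p) = e K p 0 := by
        unfold basisW0pow; rw [if_pos rfl]; rfl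
      rw [this, coeff_e (by omega) (by omega), if_pos rfl, mul_one, ← hl']
      ring
    · have : ((basisW0pow K p ⟨i, hi, hi'⟩ : W0 K p) : Witt K p) = 0 := by
        unfold basisW0pow; rw [if_neg h]; rfl
      rw [this, coeff_e (by omega) (by omega), if_neg (Ne.symm h), map_zero,
        apply_e_eq_zero_of_height_le hχ (by omega), mul_zero, zero_pow hp, add_zero])

variable [Fact p.Prime]

/-- The one-dimensional `U_χ(W_0)`-module `K_l`: the space `K` with `e_0 · 1 = l` and
`e_i · 1 = 0` for `i ≠ 0`. -/
@[nolint unusedArguments]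
def WeightModule (χ : Module.Dual K (Witt K p)) (_ : height χ ≤ 1) (l : K)
    (_ : l ∈ weights χ) : Type u := K

instance (χ : Module.Dual K (Witt K p)) (hχ : height χ ≤ 1) (l : K) (hl : l ∈ weights χ) :
    AddCommGroup (WeightModule χ hχ l hl) := inferInstanceAs (AddCommGroup K)

noncomputable instance (χ : Module.Dual K (Witt K p)) (hχ : height χ ≤ 1) (l : K)
    (hl : l ∈ weights χ) : Module (UW0 χ) (WeightModule χ hχ l hl) :=
  Module.compHom K (characterUW0 χ hχ l hl).toRingHom

/-- The reduced Verma module `V_χ(l) = U_χ(W) ⊗_{U_χ(W_0)} K_l`, a `U_χ(W)`-module. -/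
abbrev Verma (χ : Module.Dual K (Witt K p)) (hχ : height χ ≤ 1) (l : K)
    (hl : l ∈ weights χ) : Type u :=
  InducedModule (UW0toUW χ).toRingHom (WeightModule χ hχ l hl)

/-- The `K`-vector space `Ext¹_{U_χ(W_0)}(K_{l'}, V_χ(l))`, where `V_χ(l)` is regarded as a
`U_χ(W_0)`-module by restriction. -/
abbrev ExtOne (χ : Module.Dual K (Witt K p)) (hχ : height χ ≤ 1) (l' l : K)
    (hl' : l' ∈ weights χ) (hl : l ∈ weights χ) : Type u :=
  CategoryTheory.Abelian.Ext.{u}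
    (ModuleCat.of (UW0 χ) (WeightModule χ hχ l' hl'))
    ((ModuleCat.restrictScalars (UW0toUW χ).toRingHom).obj
      (ModuleCat.of (UW χ) (Verma χ hχ l hl))) 1

/-- The set `Θ(χ)`: the pairs `(0, p-1)` and `(p-1, 0)`, as far as they lie in `Λ(χ) × Λ(χ)`,
together with the diagonal of `Λ(χ) × Λ(χ)`. -/
def Theta (χ : Module.Dual K (Witt K p)) : Set (K × K) :=
  (({((0 : K), (p : K) - 1), ((p : K) - 1, (0 : K))} : Set (K × K)) ∩ weights χ ×ˢ weights χ) ∪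
    {q | ∃ l ∈ weights χ, q = (l, l)}

/-- For `m` in the prime field, the representative `[m] ∈ {0, …, p-1}`: the least natural number
whose image in `K` is `m`. -/
noncomputable def residue (m : K) : ℕ := sInf {n : ℕ | (n : K) = m}

/-- The list of cases for `Ext¹_{U_χ(W_0)}(K_{l'}, V_χ(l))` to be one-dimensional. Here
`2 l = 5 ± √19`, with `±√19` the roots of `x ^ 2 - 19` in `K`. -/
def IsExceptional (p : ℕ) (l l' : K) : Prop :=
  (residue (l - l') = 1 ∧ (l = 1 ∨ l = (p : K) - 1)) ∨
  (residue (l - l') = 2 ∨ residue (l - l') = 3) ∨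
  (residue (l - l') = 4 ∧ 5 < p) ∨
  (residue (l - l') = 4 ∧ (l = 0 ∨ l = 3)) ∨
  (residue (l - l') = 5 ∧ (l = 0 ∨ l = 4)) ∨
  (residue (l - l') = 6 ∧ (∃ s : K, s ^ 2 = 19 ∧ 2 * l = 5 + s) ∧ 7 < p)

end Modules

end Witt

/-!
The theorem rests on three reductions and a small computation.

*Crossed homomorphisms.* The one-dimensional module `K_{l'}` is the quotient of `A = U_χ(W_0)` by
the kernel of a character `ε`, and `A` is projective. Hence `Ext¹(K_{l'}, Y)` is the space of
homomorphisms from the augmentation ideal `ker ε` to `Y` modulo those that extend to `A`, that is,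
the space of crossed homomorphisms `d : A → Y`, `d (a b) = a d(b) + ε(b) d(a)`, modulo the inner
ones (`subsingleton_ext_of_crossedHom`, `nonempty_ext_equiv_of_crossedHom`).

*The module.* The reduced Verma module is identified with `K ^ p`, with basis `u_k`,
`0 ≤ k < p`, on which `e_i` acts by `e_i u_k = ((i + 1) l + i - k) u_{k - i}`
(`vermaEquivDensity`). The operators satisfy the relations of `U_χ(W)`, which gives a map from
the Verma module onto `K ^ p`; it is injective because the powers of `e_{-1}` below the `p`-th span
the Verma module. The weight spaces of `e_0` on the module are one-dimensional.

*Normalization.* Let `r` be the residue of `l - l'`; it is not `0` since `(l, l)` lies in `Θ(χ)`.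
The relation for `e_0 ^ p` kills the component of weight `l'` of `d(e_0)`, and every other component
can be removed by an inner crossed homomorphism, so that `d(e_0) = 0`. Then `d(e_i)` has weight
`l' + i`, and `e_1 u_r = (2 l - r + 1) u_{r - 1}` with a nonzero coefficient, because
`l + l' ≠ -1`; so `d(e_1) = 0` can also be achieved (`exists_normalization`). As `e_1` and `e_2`
generate the `e_i` with `i ≥ 1`, only the scalar `d(e_2)` is left, and it is an invariant of the
class: the dimension of `Ext¹` is at most one (`crossedHom_isReducedCocycle`). Conversely, a cocycle
on `W_0` with `d(e_1) = 0` extends to `U_χ(W_0)`: it defines a block triangular representation of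
`W_0`, which respects the `p`-th power relations (`exists_crossedHom_of_cocycle`).

*The computation.* Write `d(e_i) = c_i u_{r - i}` and `x = 2 l - r`, where `x + 1 ≠ 0`. The brackets
with `e_1` determine all `c_i` from `c_2`. Comparing `[e_1, e_4]` with `[e_2, e_3]` gives
`(x (x + 5) - 6 l) c_2 = 0` once `r ≥ 5`, and comparing `[e_1, e_6]` with `[e_3, e_4]` rules out
`r ≥ 7` (`IsReducedCocycle.apply_two_eq_zero`). For `r = 5` and `r = 6` the quadratic equation has
the roots `l = 0, 4` and `2 l = 5 ± √19`. The vanishing of `e_i` for `i ≥ p - 1` gives the extra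
conditions for `r = 4`, `p = 5` and for `r = 6`, `p = 7`. For `r = 1` the indices wrap around
modulo `p`, so that `d(e_i) = c_i u_{p + 1 - i}` for `i ≥ 2`, and the quadratic equation leaves
`l = 1` and `l = -1`. In all remaining cases a cocycle with `c_2 ≠ 0` is written down
(`exists_isReducedCocycle`).
-/

/-! ### `Ext¹` and crossed homomorphisms -/

section CrossedHoms

open CategoryTheory

variable {K : Type u} [Field K] {A : Type u} [Ring A] [Algebra K A]

/-- The connecting map of the exact sequence `0 → ker g → A → X → 0`: every extension class of `X`
by `Y` comes from a homomorphism `ker g → Y`, and the class is trivial if and only if the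
homomorphism extends to `A`. -/
theorem exists_connecting_hom {X Y : Type u} [AddCommGroup X] [Module A X] [AddCommGroup Y]
    [Module A Y] (g : A →ₗ[A] X) (hg : Function.Surjective g) :
    ∃ δ : (LinearMap.ker g →ₗ[A] Y) →
        Abelian.Ext.{u} (ModuleCat.of A X) (ModuleCat.of A Y) 1,
      Function.Surjective δ ∧ (∀ f f', δ (f + f') = δ f + δ f') ∧
      (∀ f, δ f = 0 ↔ ∃ y : Y, ∀ a : LinearMap.ker g, f a = (a : A) • y) ∧
      ∀ (c : K) (f f' : LinearMap.ker g →ₗ[A] Y),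
        (∀ a, f' a = algebraMap K A c • f a) → δ f' = c • δ f := by
  let S : ShortComplex (ModuleCat.{u} A) :=
    { X₁ := ModuleCat.of A (LinearMap.ker g)
      X₂ := ModuleCat.of A A
      X₃ := ModuleCat.of A X
      f := ModuleCat.ofHom (LinearMap.ker g).subtype
      g := ModuleCat.ofHom g
      zero := by ext a; exact a.2 }
  have hS : S.ShortExact := by
    refine { exact := ?_, mono_f := ?_, epi_g := ?_ }
    · rw [ShortComplex.moduleCat_exact_iff]
      intro a ha
      exact ⟨⟨a, ha⟩, rfl⟩
    · exact (ModuleCat.mono_iff_injective _).2 Subtype.val_injective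
    · exact (ModuleCat.epi_iff_surjective _).2 hg
  have hproj : Projective S.X₂ := ModuleCat.projective_of_free (Module.Basis.singleton Unit A)
  let F (f : LinearMap.ker g →ₗ[A] Y) : S.X₁ ⟶ ModuleCat.of A Y := ModuleCat.ofHom f
  refine ⟨fun f => hS.extClass.comp (Abelian.Ext.mk₀ (F f)) (add_zero 1), ?_, ?_, ?_, ?_⟩
  · intro e
    obtain ⟨f, hf⟩ := Abelian.Ext.contravariant_sequence_exact₃ hS (ModuleCat.of A Y) e
      (Abelian.Ext.eq_zero_of_projective _) (add_zero 1)
    obtain ⟨f, rfl⟩ := Abelian.Ext.addEquiv₀.symm.surjective f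
    exact ⟨f.hom, hf⟩
  · intro f f'
    have h1 : F (f + f') = F f + F f' := rfl
    dsimp only
    rw [h1, Abelian.Ext.mk₀_add, Abelian.Ext.comp_add]
  · intro f
    constructor
    · intro h
      obtain ⟨y, hy⟩ := Abelian.Ext.contravariant_sequence_exact₁ hS (ModuleCat.of A Y) _
        (add_zero 1) h
      obtain ⟨y, rfl⟩ := Abelian.Ext.addEquiv₀.symm.surjective y
      have hy' : S.f ≫ y = F f := by
        apply Abelian.Ext.addEquiv₀.symm.injective
        exact (Abelian.Ext.mk₀_comp_mk₀ _ _).symm.trans hy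
      refine ⟨y.hom (1 : A), fun a => ?_⟩
      have h1 : y.hom (a : A) = f a := by
        have := congrArg (fun q => q.hom a) hy'
        exact this
      rw [← h1, ← map_smul, smul_eq_mul, mul_one]
    · rintro ⟨y, hy⟩
      have h1 : F f = S.f ≫ ModuleCat.ofHom (LinearMap.toSpanSingleton A Y y) := by
        ext a
        exact hy a
      dsimp only
      rw [h1, ← Abelian.Ext.mk₀_comp_mk₀, hS.extClass_comp_assoc]
  · intro c f f' h
    have h1 : F f' = c • F f := by
      ext a
      exact h a
    dsimp only
    rw [h1, Abelian.Ext.mk₀_smul, Abelian.Ext.comp_smul]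

variable {X Y : Type u} [AddCommGroup X] [Module A X] [AddCommGroup Y] [Module K Y] [Module A Y]

/-- A crossed homomorphism `d : A → Y` with respect to an augmentation `ε`, that is, a derivation
for the left action of `A` on `Y` and the right action through `ε`. -/
def IsCrossedHom (ε : A →ₐ[K] K) (d : A →ₗ[K] Y) : Prop :=
  ∀ a b, d (a * b) = a • d b + ε b • d a

theorem IsCrossedHom.apply_one {ε : A →ₐ[K] K} {d : A →ₗ[K] Y} (hd : IsCrossedHom ε d) :
    d 1 = 0 := by
  have := hd 1 1
  rw [mul_one, map_one ε, one_smul, one_smul] at this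
  simpa using this

variable [IsScalarTower K A Y]

/-- The homomorphism on the augmentation ideal given by a crossed homomorphism. -/
def IsCrossedHom.toHom {ε : A →ₐ[K] K} {d : A →ₗ[K] Y} (hd : IsCrossedHom ε d) (g : A →ₗ[A] X)
    (hker : ∀ a, g a = 0 → ε a = 0) : LinearMap.ker g →ₗ[A] Y where
  toFun a := d a
  map_add' a b := by simp
  map_smul' a b := by
    have := hd a b
    rw [hker b b.2, zero_smul, add_zero] at this
    exact this

/-- Every homomorphism `f` on the augmentation ideal comes from the crossed homomorphism
`a ↦ f (a - ε a)`. -/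
theorem exists_crossedHom (ε : A →ₐ[K] K) (g : A →ₗ[A] X) (hker : ∀ a, ε a = 0 → g a = 0)
    (hker' : ∀ a, g a = 0 → ε a = 0) (f : LinearMap.ker g →ₗ[A] Y) :
    ∃ d : A →ₗ[K] Y, IsCrossedHom ε d ∧ ∀ a : LinearMap.ker g, f a = d a := by
  have hmem (a : A) : a - algebraMap K A (ε a) ∈ LinearMap.ker g := by
    apply hker
    rw [map_sub, AlgHom.commutes]
    exact sub_self _
  let d : A →ₗ[K] Y :=
    { toFun a := f ⟨a - algebraMap K A (ε a), hmem a⟩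
      map_add' a b := by
        rw [← map_add]
        congr 1
        ext
        simp only [map_add, Submodule.coe_add]
        abel
      map_smul' c a := by
        rw [RingHom.id_apply, ← algebraMap_smul A c (f _), ← map_smul]
        congr 1
        ext
        simp only [map_smul, smul_eq_mul, map_mul, Submodule.coe_smul, mul_sub]
        rw [Algebra.smul_def] }
  refine ⟨d, fun a b => ?_, fun a => ?_⟩
  · change f _ = a • f _ + ε b • f _
    rw [← algebraMap_smul A (ε b) (f _), ← map_smul, ← map_smul, ← map_add]
    congr 1
    ext
    simp only [Submodule.coe_add, Submodule.coe_smul, smul_eq_mul, map_mul]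
    rw [mul_sub, mul_sub, Algebra.commutes (ε b) a, ← map_mul, mul_comm (ε a), map_mul]
    abel
  · change f a = f _
    congr 1
    ext
    simp [hker' a a.2]

/-- If all crossed homomorphisms are inner, then `Ext¹` vanishes. -/
theorem subsingleton_ext_of_crossedHom (ε : A →ₐ[K] K) (g : A →ₗ[A] X)
    (hg : Function.Surjective g) (hker : ∀ a, g a = 0 ↔ ε a = 0)
    (h : ∀ d : A →ₗ[K] Y, IsCrossedHom ε d → ∃ y : Y, ∀ a, d a = a • y - ε a • y) :
    Subsingleton (Abelian.Ext.{u} (ModuleCat.of A X) (ModuleCat.of A Y) 1) := by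
  obtain ⟨δ, hδ, -, hδ0, -⟩ := exists_connecting_hom (K := K) (Y := Y) g hg
  refine subsingleton_of_forall_eq 0 fun e => ?_
  obtain ⟨f, rfl⟩ := hδ e
  obtain ⟨d, hd, hf⟩ := exists_crossedHom ε g (fun a => (hker a).2) (fun a => (hker a).1) f
  obtain ⟨y, hy⟩ := h d hd
  refine (hδ0 f).2 ⟨y, fun a => ?_⟩
  rw [hf, hy, (hker a).1 a.2, zero_smul, sub_zero]

/-- If the crossed homomorphisms are spanned by a non-inner one and the inner ones, then `Ext¹` is
one-dimensional. -/
theorem nonempty_ext_equiv_of_crossedHom (ε : A →ₐ[K] K) (g : A →ₗ[A] X)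
    (hg : Function.Surjective g) (hker : ∀ a, g a = 0 ↔ ε a = 0)
    (d₀ : A →ₗ[K] Y) (hd₀ : IsCrossedHom ε d₀) (hne : ¬ ∃ y : Y, ∀ a, d₀ a = a • y - ε a • y)
    (h : ∀ d : A →ₗ[K] Y, IsCrossedHom ε d →
      ∃ (t : K) (y : Y), ∀ a, d a = t • d₀ a + (a • y - ε a • y)) :
    Nonempty (Abelian.Ext.{u} (ModuleCat.of A X) (ModuleCat.of A Y) 1 ≃ₗ[K] K) := by
  obtain ⟨δ, hδ, hadd, hδ0, hsmul⟩ := exists_connecting_hom (K := K) (Y := Y) g hg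
  set f₀ := hd₀.toHom g (fun a => (hker a).1) with hf₀
  have hf₀ne : δ f₀ ≠ 0 := by
    intro h0
    obtain ⟨y, hy⟩ := (hδ0 f₀).1 h0
    refine hne ⟨y, fun a => ?_⟩
    have h1 := hy ⟨a - algebraMap K A (ε a), by
      rw [LinearMap.mem_ker, hker, map_sub, AlgHom.commutes]; exact sub_self _⟩
    change d₀ (a - algebraMap K A (ε a)) = (a - algebraMap K A (ε a)) • y at h1
    rwa [map_sub, Algebra.algebraMap_eq_smul_one, map_smul, hd₀.apply_one, smul_zero, sub_zero,
      sub_smul, smul_assoc, one_smul] at h1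
  have hspan (e : Abelian.Ext.{u} (ModuleCat.of A X) (ModuleCat.of A Y) 1) :
      ∃ t : K, t • δ f₀ = e := by
    obtain ⟨f, rfl⟩ := hδ e
    obtain ⟨d, hd, hf⟩ := exists_crossedHom ε g (fun a => (hker a).2) (fun a => (hker a).1) f
    obtain ⟨t, y, hy⟩ := h d hd
    refine ⟨t, ?_⟩
    -- `f = t f₀ + (inner part)`, and the inner part `f₂` extends to `A`
    let f₁ : LinearMap.ker g →ₗ[A] Y :=
      { toFun a := algebraMap K A t • f₀ a
        map_add' a b := by rw [map_add, smul_add]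
        map_smul' a b := by
          rw [map_smul, smul_smul, RingHom.id_apply, smul_smul, Algebra.commutes] }
    let f₂ : LinearMap.ker g →ₗ[A] Y :=
      (LinearMap.toSpanSingleton A Y y).comp (LinearMap.ker g).subtype
    have h2 : f = f₁ + f₂ := by
      ext a
      rw [hf, hy, (hker a).1 a.2, zero_smul, sub_zero]
      change _ = algebraMap K A t • d₀ a + (a : A) • y
      rw [algebraMap_smul]
    rw [h2, hadd, (hδ0 f₂).2 ⟨y, fun a => rfl⟩, add_zero]
    exact (hsmul t f₀ f₁ fun a => rfl).symm
  exact ⟨(LinearEquiv.ofBijective (LinearMap.toSpanSingleton K _ (δ f₀))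
    ⟨fun s t hst => by simpa [hf₀ne] using hst, hspan⟩).symm⟩

end CrossedHoms

/-! ### The density representation of the Witt algebra -/

namespace Witt

section Density

attribute [local instance] LieRing.ofAssociativeRing

variable {K : Type u} [Field K] {p : ℕ}

theorem exists_deg_eq {i : ℤ} (h : -1 ≤ i) (h' : i ≤ (p : ℤ) - 2) : ∃ k : Fin p, deg k = i :=
  ⟨⟨(i + 1).toNat, by omega⟩, by unfold deg; simp only; omega⟩

theorem deg_injective : Function.Injective (deg : Fin p → ℤ) := by
  intro a b h
  unfold deg at h
  ext
  omega

/-- The linear map on `W` that sends `e_i` to `T i`. -/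
def linearExtension {V : Type*} [AddCommGroup V] [Module K V] (T : ℤ → V) : Witt K p →ₗ[K] V where
  toFun x := ∑ k, x k • T (deg k)
  map_add' x y := by simp only [add_apply, add_smul, Finset.sum_add_distrib]
  map_smul' c x := by simp only [smul_apply, mul_smul, Finset.smul_sum, RingHom.id_apply]

theorem linearExtension_apply {V : Type*} [AddCommGroup V] [Module K V] (T : ℤ → V)
    (x : Witt K p) : linearExtension T x = ∑ k, x k • T (deg k) := rfl

theorem linearExtension_e {V : Type*} [AddCommGroup V] [Module K V] (T : ℤ → V) {i : ℤ}
    (h : -1 ≤ i) (h' : i ≤ (p : ℤ) - 2) : linearExtension T (e K p i) = T i := by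
  obtain ⟨k, rfl⟩ := exists_deg_eq h h'
  rw [linearExtension_apply, Finset.sum_eq_single k]
  · simp [e]
  · intro j _ hj
    simp [e, deg_injective.ne hj]
  · intro h; exact absurd (Finset.mem_univ k) h

theorem sum_structureConst_smul {V : Type*} [AddCommGroup V] [Module K V] {T : ℤ → V}
    (hT : ∀ i, (p : ℤ) - 1 ≤ i → T i = 0) (a b : Fin p) :
    ∑ k, structureConst K a b k • T (deg k) =
      ((deg b - deg a : ℤ) : K) • T (deg a + deg b) := by
  have ha := a.isLt
  have hb := b.isLt
  by_cases h : -1 ≤ deg a + deg b ∧ deg a + deg b ≤ (p : ℤ) - 2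
  · obtain ⟨k, hk⟩ := exists_deg_eq (p := p) h.1 h.2
    rw [Finset.sum_eq_single k]
    · rw [structureConst, if_pos hk.symm, hk]
    · intro j _ hj
      rw [structureConst, if_neg, zero_smul]
      rw [← hk]
      exact deg_injective.ne hj.symm
    · intro h; exact absurd (Finset.mem_univ k) h
  · rw [Finset.sum_eq_zero]
    · by_cases h2 : (p : ℤ) - 1 ≤ deg a + deg b
      · rw [hT _ h2, smul_zero]
      · have : deg b - deg a = 0 := by unfold deg at *; omega
        rw [this, Int.cast_zero, zero_smul]
    · intro k _
      have := k.isLt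
      rw [structureConst, if_neg, zero_smul]
      unfold deg at *
      omega

/-- A family of elements of an associative algebra that satisfies the commutator relations of the
`e_i` with `i ≥ n` gives a Lie homomorphism on `W_n`. -/
theorem linearExtension_lie {A : Type*} [Ring A] [Algebra K A] {T : ℤ → A} (n : ℤ)
    (hT0 : ∀ i, (p : ℤ) - 1 ≤ i → T i = 0)
    (hT : ∀ i j, n ≤ i → i ≤ (p : ℤ) - 2 → n ≤ j → j ≤ (p : ℤ) - 2 → -1 ≤ i → -1 ≤ j →
      T i * T j - T j * T i = ((j - i : ℤ) : K) • T (i + j))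
    {x y : Witt K p} (hx : x ∈ filtration K p n) (hy : y ∈ filtration K p n) :
    linearExtension T ⁅x, y⁆ =
      linearExtension T x * linearExtension T y - linearExtension T y * linearExtension T x := by
  have h1 : linearExtension T ⁅x, y⁆ =
      ∑ a, ∑ b, (x a * y b) • ∑ k, structureConst K a b k • T (deg k) := by
    simp only [linearExtension_apply, bracket_apply, Finset.sum_smul, Finset.smul_sum]
    rw [Finset.sum_comm]
    refine Finset.sum_congr rfl fun a _ => ?_
    rw [Finset.sum_comm]
    refine Finset.sum_congr rfl fun b _ => Finset.sum_congr rfl fun k _ => ?_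
    rw [smul_smul, mul_comm]
  have h2 : linearExtension T y * linearExtension T x =
      ∑ a, ∑ b, (x a * y b) • (T (deg b) * T (deg a)) := by
    rw [linearExtension_apply, linearExtension_apply, Finset.sum_mul_sum, Finset.sum_comm]
    refine Finset.sum_congr rfl fun a _ => Finset.sum_congr rfl fun b _ => ?_
    rw [smul_mul_smul_comm, mul_comm (y b)]
  have h3 : linearExtension T x * linearExtension T y =
      ∑ a, ∑ b, (x a * y b) • (T (deg a) * T (deg b)) := by
    rw [linearExtension_apply, linearExtension_apply, Finset.sum_mul_sum]
    refine Finset.sum_congr rfl fun a _ => Finset.sum_congr rfl fun b _ => ?_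
    rw [smul_mul_smul_comm]
  rw [h1, h2, h3, ← Finset.sum_sub_distrib]
  refine Finset.sum_congr rfl fun a _ => ?_
  rw [← Finset.sum_sub_distrib]
  refine Finset.sum_congr rfl fun b _ => ?_
  have ha' := a.isLt
  have hb' := b.isLt
  by_cases ha : deg a < n
  · rw [hx a ha]; simp
  by_cases hb : deg b < n
  · rw [hy b hb]; simp
  rw [sum_structureConst_smul hT0, ← smul_sub,
    hT _ _ (by omega) (by unfold deg; omega) (by omega) (by unfold deg; omega)
      (by unfold deg; omega) (by unfold deg; omega)]

/-- The coordinate of a vector of `K ^ p` at an integer `m`, equal to zero unless `0 ≤ m < p`. -/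
def coord (m : ℤ) : (Fin p → K) →ₗ[K] K where
  toFun f := if h : 0 ≤ m ∧ m < p then f ⟨m.toNat, by omega⟩ else 0
  map_add' f g := by split_ifs <;> simp
  map_smul' c f := by split_ifs <;> simp

theorem coord_natCast (f : Fin p → K) (k : Fin p) : coord (k : ℤ) f = f k := by
  have := k.isLt
  exact dif_pos ⟨by omega, by omega⟩

theorem coord_of_le {m : ℤ} (h : (p : ℤ) ≤ m) (f : Fin p → K) : coord m f = 0 :=
  dif_neg (by omega)

theorem ext_coord {f g : Fin p → K} (h : ∀ m : ℤ, 0 ≤ m → m < p → coord m f = coord m g) :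
    f = g := by
  funext k
  have := k.isLt
  rw [← coord_natCast f, ← coord_natCast g]
  exact h _ (by omega) (by omega)

theorem coord_mk (F : ℤ → K) {m : ℤ} (h : 0 ≤ m) (h' : m < p) :
    coord m (fun k : Fin p => F k) = F m := by
  have h1 : coord m (fun k : Fin p => F k) = F (m.toNat : ℤ) := dif_pos ⟨h, h'⟩
  rw [h1, Int.toNat_of_nonneg h]

/-- The operator by which `e_i` acts on the reduced Verma module, in the basis
`u_k = (-1) ^ k / k! • e_{-1} ^ k ⊗ 1`: one has `e_i u_k = ((i + 1) l + i - k) u_{k - i}` with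
`u_k = 0` for `k < 0`, except that `e_{-1} u_{p-1} = -a u_0`, where `a = χ(e_{-1}) ^ p`. -/
def densityOp (p : ℕ) (a l : K) (i : ℤ) : Module.End K (Fin p → K) where
  toFun f k := ((i + 1 : ℤ) * l - (k : ℤ)) * coord ((k : ℤ) + i) f +
    if i = -1 ∧ (k : ℤ) = 0 then -a * coord ((p : ℤ) - 1) f else 0
  map_add' f g := by
    funext k
    simp only [map_add, Pi.add_apply]
    split_ifs <;> ring
  map_smul' c f := by
    funext k
    simp only [map_smul, Pi.smul_apply, smul_eq_mul, RingHom.id_apply]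
    split_ifs <;> ring

theorem coord_densityOp (a l : K) (i : ℤ) (f : Fin p → K) {m : ℤ} (h : 0 ≤ m) (h' : m < p) :
    coord m (densityOp p a l i f) = ((i + 1 : ℤ) * l - m) * coord (m + i) f +
      if i = -1 ∧ m = 0 then -a * coord ((p : ℤ) - 1) f else 0 :=
  coord_mk (fun m => ((i + 1 : ℤ) * l - m) * coord (m + i) f +
      if i = -1 ∧ m = 0 then -a * coord ((p : ℤ) - 1) f else 0) h h'

theorem coord_densityOp_of_nonneg (a l : K) {i : ℤ} (hi : 0 ≤ i) (f : Fin p → K) {m : ℤ}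
    (h : 0 ≤ m) :
    coord m (densityOp p a l i f) = ((i + 1 : ℤ) * l - m) * coord (m + i) f := by
  by_cases h' : m < p
  · rw [coord_densityOp a l i f h h', if_neg (by omega), add_zero]
  · rw [coord_of_le (by omega), coord_of_le (by omega), mul_zero]

theorem coord_densityOp_neg_one (a l : K) (f : Fin p → K) {m : ℤ} (h : 0 < m) (h' : m < p) :
    coord m (densityOp p a l (-1) f) = -m * coord (m - 1) f := by
  rw [coord_densityOp a l (-1) f h.le h', if_neg (by omega)]
  simp [sub_eq_add_neg]

theorem coord_zero_densityOp_neg_one (a l : K) (f : Fin p → K) (hp : 0 < p) :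
    coord 0 (densityOp p a l (-1) f) = -a * coord ((p : ℤ) - 1) f := by
  rw [coord_densityOp a l (-1) f le_rfl (by omega), if_pos ⟨rfl, rfl⟩]
  simp

theorem densityOp_commutator_of_nonneg (a l : K) {i j : ℤ} (hi : 0 ≤ i) (hj : 0 ≤ j) :
    densityOp p a l i * densityOp p a l j - densityOp p a l j * densityOp p a l i =
      ((j - i : ℤ) : K) • densityOp p a l (i + j) := by
  refine LinearMap.ext fun f => ext_coord fun m h h' => ?_
  simp only [LinearMap.sub_apply, Module.End.mul_apply, LinearMap.smul_apply, map_sub, map_smul,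
    smul_eq_mul]
  rw [coord_densityOp_of_nonneg a l hi _ h, coord_densityOp_of_nonneg a l hj _ h,
    coord_densityOp_of_nonneg a l hi _ (by omega), coord_densityOp_of_nonneg a l hj _ (by omega),
    coord_densityOp_of_nonneg a l (by omega) _ h, show m + j + i = m + i + j by ring,
    show m + (i + j) = m + i + j by ring]
  push_cast
  ring

theorem coord_densityOp_zero_pow (a l : K) (n : ℕ) (f : Fin p → K) {m : ℤ} (h : 0 ≤ m) :
    coord m ((densityOp p a l 0 ^ n) f) = (l - m) ^ n * coord m f := by
  induction n with
  | zero => simp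
  | succ n ih =>
    rw [pow_succ', Module.End.mul_apply, coord_densityOp_of_nonneg a l le_rfl _ h, add_zero, ih]
    push_cast
    ring

theorem coord_densityOp_pow (a l : K) {i : ℤ} (hi : 0 ≤ i) (n : ℕ) (f : Fin p → K) {m : ℤ}
    (h : 0 ≤ m) (h' : (p : ℤ) ≤ m + n * i) : coord m ((densityOp p a l i ^ n) f) = 0 := by
  induction n generalizing m with
  | zero => exact coord_of_le (by simpa using h') _
  | succ n ih =>
    rw [pow_succ', Module.End.mul_apply, coord_densityOp_of_nonneg a l hi _ h,
      ih (by omega) (by push_cast at h'; linarith), mul_zero]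

/-- The vector `u_k` of the standard basis, zero unless `0 ≤ k < p`. -/
def unit (K : Type u) [Field K] (p : ℕ) (k : ℤ) : Fin p → K := fun m => if (m : ℤ) = k then 1 else 0

theorem coord_unit (k : ℤ) {m : ℤ} (h : 0 ≤ m) (h' : m < p) :
    coord m (unit K p k) = if m = k then 1 else 0 :=
  coord_mk (fun m => if m = k then 1 else 0) h h'

theorem eq_sum_unit (f : Fin p → K) : f = ∑ k : Fin p, f k • unit K p k := by
  funext m
  rw [Finset.sum_apply, Finset.sum_eq_single m]
  · simp [unit]
  · intro k _ hk
    have : ¬ (m : ℤ) = (k : ℤ) := fun h => hk (Fin.ext (by omega))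
    simp [unit, this]
  · intro h; exact absurd (Finset.mem_univ m) h

theorem densityOp_neg_one_unit (a l : K) {k : ℤ} (hk : 0 ≤ k) (hk' : k + 1 < p) :
    densityOp p a l (-1) (unit K p k) = -((k : K) + 1) • unit K p (k + 1) := by
  refine ext_coord fun m h h' => ?_
  rw [map_smul, coord_unit _ h h', smul_eq_mul]
  obtain rfl | hm := h.eq_or_lt
  · rw [coord_zero_densityOp_neg_one a l _ (by omega), coord_unit _ (by omega) (by omega),
      if_neg (by omega), if_neg (by omega)]
    simp
  · rw [coord_densityOp_neg_one a l _ hm h', coord_unit _ (by omega) (by omega)]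
    by_cases h1 : m = k + 1
    · rw [if_pos (by omega), if_pos h1, h1]; push_cast; ring
    · rw [if_neg (by omega), if_neg h1]; simp

theorem densityOp_neg_one_pow_unit (a l : K) (k : ℕ) (hk : k < p) :
    (densityOp p a l (-1) ^ k) (unit K p 0) = ((-1) ^ k * (k.factorial : K)) • unit K p k := by
  induction k with
  | zero => simp
  | succ k ih =>
    rw [pow_succ', Module.End.mul_apply, ih (by omega), map_smul,
      densityOp_neg_one_unit a l (by omega) (by omega), smul_smul]
    push_cast [Nat.factorial_succ]
    congr 1
    ring

variable [CharP K p]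

theorem densityOp_eq_zero (a l : K) (i : ℤ) (hi : (p : ℤ) - 1 ≤ i) (hp : 0 < p) :
    densityOp p a l i = 0 := by
  refine LinearMap.ext fun f => ext_coord fun m h h' => ?_
  rw [coord_densityOp_of_nonneg a l (by omega) f h, LinearMap.zero_apply, map_zero]
  by_cases hm : m = 0 ∧ i = (p : ℤ) - 1
  · rw [hm.1, hm.2]; simp
  · rw [coord_of_le (by omega), mul_zero]

theorem densityOp_commutator_neg_one (a l : K) {j : ℤ} (hj : 0 ≤ j) (hp : 1 < p) :
    densityOp p a l (-1) * densityOp p a l j - densityOp p a l j * densityOp p a l (-1) =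
      ((j + 1 : ℤ) : K) • densityOp p a l (-1 + j) := by
  refine LinearMap.ext fun f => ext_coord fun m h h' => ?_
  simp only [LinearMap.sub_apply, Module.End.mul_apply, LinearMap.smul_apply, map_sub, map_smul,
    smul_eq_mul]
  rw [coord_densityOp_of_nonneg a l hj _ h]
  obtain rfl | hm := h.eq_or_lt
  · rw [coord_zero_densityOp_neg_one a l _ (by omega),
      coord_densityOp_of_nonneg a l hj _ (by omega), coord_densityOp a l _ _ le_rfl (by omega)]
    obtain rfl | hj' := hj.eq_or_lt
    · rw [show (0 : ℤ) + 0 = 0 by rfl, coord_zero_densityOp_neg_one a l _ (by omega),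
        if_pos (by omega)]
      push_cast
      simp
      ring
    · rw [coord_of_le (by omega), if_neg (by omega)]
      by_cases hjp : j < p
      · rw [show 0 + j = j by ring, coord_densityOp_neg_one a l _ hj' hjp,
          show 0 + (-1 + j) = j - 1 by ring]
        push_cast
        ring
      · by_cases hjp' : j = p
        · rw [coord_of_le (by omega) (densityOp p a l (-1) f), hjp']
          simp
        · rw [coord_of_le (by omega) (densityOp p a l (-1) f), coord_of_le (by omega)]
          simp
  · rw [coord_densityOp_neg_one a l _ hm h', coord_densityOp a l _ _ h h', if_neg (by omega),
      coord_densityOp_of_nonneg a l hj _ (by omega)]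
    by_cases hjp : m + j < p
    · rw [coord_densityOp_neg_one a l _ (by omega) hjp,
        show m + (-1 + j) = m + j - 1 by ring, show m - 1 + j = m + j - 1 by ring]
      push_cast
      ring
    · rw [coord_of_le (by omega) (densityOp p a l (-1) f)]
      by_cases hjp' : m + j = p
      · rw [show m + (-1 + j) = m - 1 + j by ring, show j = p - m by omega]
        push_cast
        simp
        ring
      · rw [coord_of_le (by omega), coord_of_le (by omega)]
        simp

theorem densityOp_commutator (a l : K) {i j : ℤ} (hi : -1 ≤ i) (hj : -1 ≤ j) (hp : 1 < p) :
    densityOp p a l i * densityOp p a l j - densityOp p a l j * densityOp p a l i =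
      ((j - i : ℤ) : K) • densityOp p a l (i + j) := by
  obtain rfl | hi := hi.eq_or_lt
  · obtain rfl | hj := hj.eq_or_lt
    · simp
    · rw [densityOp_commutator_neg_one a l (by omega) hp, sub_neg_eq_add]
  · obtain rfl | hj := hj.eq_or_lt
    · rw [← neg_sub, densityOp_commutator_neg_one a l (by omega) hp, 
        ← neg_smul (M := Module.End K (Fin p → K)), add_comm i (-1)]
      congr 1
      push_cast
      ring
    · exact densityOp_commutator_of_nonneg a l (by omega) (by omega)

theorem neg_one_pow_mul_factorial_ne_zero [Fact p.Prime] {k : ℕ} (hk : k < p) :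
    ((-1) ^ k * (k.factorial : K)) ≠ 0 := by
  refine mul_ne_zero (pow_ne_zero _ (neg_ne_zero.2 one_ne_zero)) ?_
  rw [Ne, CharP.cast_eq_zero_iff K p, (Fact.out : p.Prime).dvd_factorial]
  omega

/-- By Wilson's theorem, `e_{-1} ^ p u_0 = (-1) ^ (p - 1) (p - 1)! e_{-1} u_{p-1} = a u_0`. -/
theorem densityOp_neg_one_pow_unit_prime [Fact p.Prime] (a l : K) :
    (densityOp p a l (-1) ^ p) (unit K p 0) = a • unit K p 0 := by
  have hp := (Fact.out : p.Prime).two_le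
  have hw : (((p - 1).factorial : ℕ) : K) = -1 := by
    have := congrArg (ZMod.castHom (dvd_refl p) K) (ZMod.wilsons_lemma p)
    rwa [map_natCast, map_neg, map_one] at this
  have hs : ((-1 : K)) ^ (p - 1) = 1 := by
    have := congrArg (ZMod.castHom (dvd_refl p) K)
      (ZMod.pow_card_sub_one_eq_one (p := p) (a := -1) (neg_ne_zero.2 one_ne_zero))
    simpa using this
  have h1 : densityOp p a l (-1) ^ p = densityOp p a l (-1) * densityOp p a l (-1) ^ (p - 1) := by
    rw [← pow_succ']
    congr 1
    omega
  rw [h1, Module.End.mul_apply, densityOp_neg_one_pow_unit a l _ (by omega), hw, hs, map_smul]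
  refine ext_coord fun m h h' => ?_
  rw [map_smul, map_smul, coord_unit _ h h', smul_eq_mul, smul_eq_mul]
  obtain rfl | hm := h.eq_or_lt
  · rw [coord_zero_densityOp_neg_one a l _ (by omega), coord_unit _ (by omega) (by omega),
      if_pos (by omega), if_pos rfl]
    ring
  · rw [coord_densityOp_neg_one a l _ hm h', coord_unit _ (by omega) (by omega),
      if_neg (by omega), if_neg (by omega)]
    ring

theorem densityOp_neg_one_pow_prime [Fact p.Prime] (a l : K) :
    densityOp p a l (-1) ^ p = algebraMap K _ a := by
  have h (k : Fin p) : (densityOp p a l (-1) ^ p) (unit K p k) = a • unit K p k := by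
    have h1 := densityOp_neg_one_pow_unit a l k k.isLt
    have h2 : unit K p k = ((-1) ^ (k : ℕ) * ((k : ℕ).factorial : K))⁻¹ •
        (densityOp p a l (-1) ^ (k : ℕ)) (unit K p 0) := by
      rw [h1, inv_smul_smul₀ (neg_one_pow_mul_factorial_ne_zero k.isLt)]
    rw [h2, map_smul, ← Module.End.mul_apply, ← pow_add, add_comm, pow_add, Module.End.mul_apply,
      densityOp_neg_one_pow_unit_prime, map_smul, smul_comm]
  refine LinearMap.ext fun f => ?_
  rw [Module.algebraMap_end_apply]
  conv_lhs => rw [eq_sum_unit f]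
  conv_rhs => rw [eq_sum_unit f]
  rw [map_sum, Finset.smul_sum]
  refine Finset.sum_congr rfl fun k _ => ?_
  rw [map_smul, h, smul_comm]

theorem sub_pow_prime [Fact p.Prime] (l : K) (m : ℤ) : (l - m) ^ p = l ^ p - m := by
  have h1 : ((m : ℤ) : K) = ZMod.castHom (dvd_refl p) K (m : ZMod p) := by simp
  rw [sub_pow_char, h1, ← map_pow, ZMod.pow_card]

/-- The representation of `W` on the reduced Verma module, as a Lie homomorphism. -/
def densityLieHom [Fact p.Prime] (a l : K) : Witt K p →ₗ⁅K⁆ Module.End K (Fin p → K) :=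
  { linearExtension (densityOp p a l) with
    map_lie' := by
      intro x y
      have hp := (Fact.out : p.Prime).two_le
      have hmem (x : Witt K p) : x ∈ filtration K p (-1) := by
        intro k hk
        unfold deg at hk
        omega
      exact linearExtension_lie (-1) (fun i hi => densityOp_eq_zero a l i hi (by omega))
        (fun i j _ _ _ _ hi hj => densityOp_commutator a l hi hj (by omega)) (hmem x) (hmem y) }

theorem densityLieHom_e [Fact p.Prime] (a l : K) {i : ℤ} (h : -1 ≤ i) (h' : i ≤ (p : ℤ) - 2) :
    densityLieHom a l (e K p i) = densityOp p a l i :=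
  linearExtension_e _ h h'

/-- The representation of `U_χ(W)` on `K ^ p` that models the reduced Verma module. -/
noncomputable def densityRep [Fact p.Prime] (χ : Module.Dual K (Witt K p)) (hχ : height χ ≤ 1)
    (l : K) (hl : l ∈ weights χ) : UW χ →ₐ[K] Module.End K (Fin p → K) :=
  ReducedEnveloping.lift (densityLieHom (χ (e K p (-1)) ^ p) l) (by
    rintro ⟨i, hi, hi'⟩
    have hp := (Fact.out : p.Prime).two_le
    have hl' : l ^ p - l = χ (e K p 0) ^ p := hl
    change densityLieHom _ l (e K p i) ^ p = densityLieHom _ l (if i = 0 then e K p i else 0) +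
      algebraMap K _ (χ (e K p i) ^ p)
    rw [densityLieHom_e _ l hi hi']
    obtain rfl | hi1 := hi.eq_or_lt
    · rw [densityOp_neg_one_pow_prime, if_neg (by omega), map_zero, zero_add]
    obtain rfl | hi0 := eq_or_ne i 0
    · rw [if_pos rfl, densityLieHom_e _ l hi hi', ← hl']
      refine LinearMap.ext fun f => ext_coord fun m h h' => ?_
      rw [coord_densityOp_zero_pow _ l p f h, LinearMap.add_apply, map_add,
        coord_densityOp_of_nonneg _ l le_rfl f h, Module.algebraMap_end_apply, map_smul,
        sub_pow_prime, add_zero, smul_eq_mul]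
      push_cast
      ring
    · rw [if_neg hi0, map_zero, zero_add, apply_e_eq_zero_of_height_le hχ (show 1 ≤ i by omega),
        zero_pow (show p ≠ 0 by omega), map_zero]
      refine LinearMap.ext fun f => ext_coord fun m h h' => ?_
      rw [coord_densityOp_pow _ l (by omega) p f h (by
        have := mul_le_mul_of_nonneg_left (show 1 ≤ i by omega) (Int.natCast_nonneg p)
        omega), LinearMap.zero_apply, map_zero])

theorem densityRep_ι [Fact p.Prime] (χ : Module.Dual K (Witt K p)) (hχ : height χ ≤ 1) (l : K)
    (hl : l ∈ weights χ) {i : ℤ} (h : -1 ≤ i) (h' : i ≤ (p : ℤ) - 2) :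
    densityRep χ hχ l hl (ReducedEnveloping.ι p (basisW K p) (basisWpow K p) χ (e K p i)) =
      densityOp p (χ (e K p (-1)) ^ p) l i := by
  rw [densityRep, ReducedEnveloping.lift_ι, densityLieHom_e _ l h h']

end Density

end Witt

/-! ### The reduced Verma module as a density module -/

section Generation

attribute [local instance] LieRing.ofAssociativeRing

variable {K : Type u} [Field K] {L : Type v} [LieRing L] [LieAlgebra K L]

theorem ReducedEnveloping.subalgebra_eq_top (p : ℕ) {I : Type w} (b b' : I → L)
    (χ : Module.Dual K L) (S : Subalgebra K (ReducedEnveloping p b b' χ))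
    (h : ∀ x, ReducedEnveloping.ι p b b' χ x ∈ S) (a : ReducedEnveloping p b b' χ) : a ∈ S := by
  obtain ⟨a, rfl⟩ := RingQuot.mkAlgHom_surjective K (ReducedRel p b b' χ) a
  have hsurj : Function.Surjective (UniversalEnvelopingAlgebra.mkAlgHom K L) :=
    RingCon.mkₐ_surjective _
  obtain ⟨a, rfl⟩ := hsurj a
  induction a using TensorAlgebra.induction with
  | algebraMap c =>
    rw [AlgHom.commutes, AlgHom.commutes]
    exact S.algebraMap_mem c
  | ι x => exact h x
  | mul a b ha hb =>
    rw [map_mul, map_mul]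
    exact S.mul_mem ha hb
  | add a b ha hb =>
    rw [map_add, map_add]
    exact S.add_mem ha hb

end Generation

namespace Witt

section VermaModel

attribute [local instance] LieRing.ofAssociativeRing

variable {K : Type u} [Field K] {p : ℕ}

theorem unit_eq_basisFun (k : Fin p) : unit K p k = Pi.basisFun K (Fin p) k := by
  funext m
  simp [unit, Pi.single_apply, Fin.ext_iff]

theorem eq_sum_e (x : Witt K p) : x = ∑ k, x k • e K p (deg k) := by
  have h : (fun k => x k) = ∑ k, (fun m => x k * e K p (deg k) m : Fin p → K) := by
    funext m
    rw [Finset.sum_apply, Finset.sum_eq_single m]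
    · simp [e]
    · intro k _ hk
      simp [e, deg_injective.ne hk.symm]
    · intro h; exact absurd (Finset.mem_univ m) h
  exact h

variable [CharP K p]

/-- A subalgebra of `U_χ(W)` that contains all `e_i` is everything. -/
theorem UW_subalgebra_eq_top (χ : Module.Dual K (Witt K p)) (S : Subalgebra K (UW χ))
    (h : ∀ i : ℤ, -1 ≤ i → i ≤ (p : ℤ) - 2 →
      ReducedEnveloping.ι p (basisW K p) (basisWpow K p) χ (e K p i) ∈ S) (a : UW χ) : a ∈ S := by
  refine ReducedEnveloping.subalgebra_eq_top _ _ _ _ S (fun x => ?_) a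
  rw [eq_sum_e x, map_sum]
  refine S.sum_mem fun k _ => ?_
  have := k.isLt
  rw [map_smul]
  exact S.smul_mem (h _ (by unfold deg; omega) (by unfold deg; omega)) _

/-- A subalgebra of `U_χ(W_0)` that contains all `e_i` with `i ≥ 0` is everything. -/
theorem UW0_subalgebra_eq_top (χ : Module.Dual K (Witt K p)) (S : Subalgebra K (UW0 χ))
    (h : ∀ i : {i : ℤ // 0 ≤ i ∧ i ≤ (p : ℤ) - 2},
      ReducedEnveloping.ι p (basisW0 K p) (basisW0pow K p) (restrictW0 χ) (basisW0 K p i) ∈ S)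
    (a : UW0 χ) : a ∈ S := by
  refine ReducedEnveloping.subalgebra_eq_top _ _ _ _ S (fun x => ?_) a
  have hx : x = ∑ k : Fin p, x.1 k •
      (if h : 0 ≤ deg k then basisW0 K p ⟨deg k, h, by unfold deg; omega⟩ else 0) := by
    apply Subtype.ext
    have h1 : ((∑ k : Fin p, x.1 k •
      (if h : 0 ≤ deg k then basisW0 K p ⟨deg k, h, by unfold deg; omega⟩ else 0) : W0 K p) :
        Witt K p) = ∑ k : Fin p, ((x.1 k •
      (if h : 0 ≤ deg k then basisW0 K p ⟨deg k, h, by unfold deg; omega⟩ else 0) : W0 K p) :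
        Witt K p) := map_sum (W0 K p).toSubmodule.subtype _ _
    rw [h1]
    conv_lhs => rw [eq_sum_e x.1]
    refine Finset.sum_congr rfl fun k _ => ?_
    split_ifs with hk
    · rfl
    · rw [x.2 k (by omega), zero_smul, zero_smul]
      rfl
  rw [hx, map_sum]
  refine S.sum_mem fun k _ => ?_
  rw [map_smul]
  refine S.smul_mem ?_ _
  split_ifs with hk
  · exact h _
  · rw [map_zero]
    exact S.zero_mem

theorem UW0toUW_ι (χ : Module.Dual K (Witt K p)) (x : W0 K p) :
    UW0toUW χ (ReducedEnveloping.ι p (basisW0 K p) (basisW0pow K p) (restrictW0 χ) x) =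
      ReducedEnveloping.ι p (basisW K p) (basisWpow K p) χ x :=
  ReducedEnveloping.lift_ι _ _ x

variable [Fact p.Prime] (χ : Module.Dual K (Witt K p)) (hχ : height χ ≤ 1) (l : K)
  (hl : l ∈ weights χ)

theorem characterUW0_ι (i : {i : ℤ // 0 ≤ i ∧ i ≤ (p : ℤ) - 2}) :
    characterUW0 χ hχ l hl
      (ReducedEnveloping.ι p (basisW0 K p) (basisW0pow K p) (restrictW0 χ) (basisW0 K p i)) =
      if i.1 = 0 then l else 0 := by
  have hp := (Fact.out : p.Prime).two_le
  rw [characterUW0, ReducedEnveloping.lift_ι, characterW0_apply]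
  change l * coeff 0 (e K p i) = _
  rw [coeff_e (by omega) (by omega)]
  simp [eq_comm]

/-- The action of `U_χ(W_0)` on the model `K ^ p` of the reduced Verma module. -/
noncomputable def densityRep0 : UW0 χ →ₐ[K] Module.End K (Fin p → K) :=
  (densityRep χ hχ l hl).comp (UW0toUW χ)

theorem densityRep0_ι (i : {i : ℤ // 0 ≤ i ∧ i ≤ (p : ℤ) - 2}) :
    densityRep0 χ hχ l hl
      (ReducedEnveloping.ι p (basisW0 K p) (basisW0pow K p) (restrictW0 χ) (basisW0 K p i)) =
      densityOp p (χ (e K p (-1)) ^ p) l i := by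
  rw [densityRep0, AlgHom.comp_apply, UW0toUW_ι]
  exact densityRep_ι χ hχ l hl (by omega) i.2.2

/-- The vector `u_0` is a highest weight vector of weight `l`. -/
theorem densityRep0_unit_zero (a : UW0 χ) :
    densityRep0 χ hχ l hl a (unit K p 0) = characterUW0 χ hχ l hl a • unit K p 0 := by
  let S : Subalgebra K (UW0 χ) :=
    { carrier := {a | densityRep0 χ hχ l hl a (unit K p 0) =
        characterUW0 χ hχ l hl a • unit K p 0}
      mul_mem' := by
        intro a b ha hb
        change densityRep0 χ hχ l hl (a * b) (unit K p 0) = _ • _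
        rw [map_mul, Module.End.mul_apply, hb, map_smul, ha, map_mul, smul_smul, mul_comm]
      add_mem' := by
        intro a b ha hb
        change densityRep0 χ hχ l hl (a + b) (unit K p 0) = _ • _
        rw [map_add, LinearMap.add_apply, ha, hb, map_add, add_smul]
      algebraMap_mem' := by
        intro c
        change densityRep0 χ hχ l hl _ (unit K p 0) = _ • _
        rw [AlgHom.commutes, AlgHom.commutes]
        rfl }
  refine UW0_subalgebra_eq_top χ S (fun i => ?_) a
  change densityRep0 χ hχ l hl _ (unit K p 0) = _ • _
  rw [densityRep0_ι, characterUW0_ι]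
  refine ext_coord fun m h h' => ?_
  rw [coord_densityOp_of_nonneg _ l i.2.1 _ h, map_smul, coord_unit _ h h', smul_eq_mul]
  have hi := i.2.1
  by_cases hm : m + i.1 < p
  · rw [coord_unit _ (by omega) hm]
    by_cases h0 : m = 0 ∧ i.1 = 0
    · rw [h0.1, h0.2]; simp
    · rw [if_neg (show ¬ m + i.1 = 0 by omega)]
      by_cases hm0 : m = 0
      · rw [if_neg (show ¬ i.1 = 0 by omega)]; simp
      · rw [if_neg hm0]; simp
  · rw [coord_of_le (by omega), mul_zero]
    by_cases hm0 : m = 0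
    · rw [if_neg (show ¬ i.1 = 0 by omega)]; simp
    · rw [if_neg hm0]; simp

/-- The space `K ^ p` with the action of `U_χ(W)` by `densityRep`: a model of the reduced Verma
module. -/
@[nolint unusedArguments]
def DensityModule (χ : Module.Dual K (Witt K p)) (_ : height χ ≤ 1) (l : K)
    (_ : l ∈ weights χ) : Type u := Fin p → K

instance : AddCommGroup (DensityModule χ hχ l hl) := inferInstanceAs (AddCommGroup (Fin p → K))

instance : Module K (DensityModule χ hχ l hl) := inferInstanceAs (Module K (Fin p → K))

noncomputable instance : Module (UW χ) (DensityModule χ hχ l hl) :=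
  Module.compHom (Fin p → K) (densityRep χ hχ l hl).toRingHom

noncomputable instance : Module (UW0 χ) (DensityModule χ hχ l hl) :=
  Module.compHom (Fin p → K) (densityRep0 χ hχ l hl).toRingHom

theorem DensityModule.smul_def (a : UW χ) (f : DensityModule χ hχ l hl) :
    a • f = densityRep χ hχ l hl a f := rfl

theorem DensityModule.smul_def' (a : UW0 χ) (f : DensityModule χ hχ l hl) :
    a • f = densityRep0 χ hχ l hl a f := rfl

instance : IsScalarTower K (UW χ) (DensityModule χ hχ l hl) where
  smul_assoc c a f := by
    rw [DensityModule.smul_def, DensityModule.smul_def, map_smul]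
    rfl

instance : IsScalarTower K (UW0 χ) (DensityModule χ hχ l hl) where
  smul_assoc c a f := by
    rw [DensityModule.smul_def', DensityModule.smul_def', map_smul]
    rfl

/-- A scalar as an element of the one-dimensional module `K_l`. -/
def weightVec (c : K) : WeightModule χ hχ l hl := c

theorem smul_weightVec (a : UW0 χ) (c : K) :
    a • weightVec χ hχ l hl c = weightVec χ hχ l hl (characterUW0 χ hχ l hl a * c) := rfl

theorem weightVec_eq_algebraMap_smul (c : K) :
    weightVec χ hχ l hl c = algebraMap K (UW0 χ) c • weightVec χ hχ l hl 1 := by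
  rw [smul_weightVec, AlgHom.commutes, mul_one]
  rfl

/-- The element `s ⊗ c` of the reduced Verma module. -/
noncomputable def vermaMk (s : UW χ) (c : WeightModule χ hχ l hl) : Verma χ hχ l hl :=
  Submodule.Quotient.mk (s ⊗ₜ[ℤ] c)

theorem vermaMk_mul (s : UW χ) (r : UW0 χ) (c : WeightModule χ hχ l hl) :
    vermaMk χ hχ l hl (s * UW0toUW χ r) c = vermaMk χ hχ l hl s (r • c) := by
  rw [vermaMk, vermaMk, Submodule.Quotient.eq]
  exact Submodule.subset_span ⟨s, r, c, rfl⟩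

theorem smul_vermaMk (s t : UW χ) (c : WeightModule χ hχ l hl) :
    s • vermaMk χ hχ l hl t c = vermaMk χ hχ l hl (s * t) c := rfl

/-- The canonical generator `1 ⊗ 1` of the reduced Verma module. -/
noncomputable def vermaGen : Verma χ hχ l hl := vermaMk χ hχ l hl 1 (weightVec χ hχ l hl 1)

theorem UW0toUW_smul_vermaGen (a : UW0 χ) :
    UW0toUW χ a • vermaGen χ hχ l hl = characterUW0 χ hχ l hl a • vermaGen χ hχ l hl := by
  rw [← algebraMap_smul (UW χ) (characterUW0 χ hχ l hl a) (vermaGen χ hχ l hl), vermaGen,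
    smul_vermaMk, smul_vermaMk, mul_one, mul_one, ← one_mul (UW0toUW χ a), vermaMk_mul,
    smul_weightVec, mul_one, weightVec_eq_algebraMap_smul, ← vermaMk_mul, one_mul,
    AlgHom.commutes]

theorem exists_smul_vermaGen (x : Verma χ hχ l hl) : ∃ s : UW χ, s • vermaGen χ hχ l hl = x := by
  obtain ⟨x, rfl⟩ := Submodule.Quotient.mk_surjective _ x
  induction x using TensorProduct.induction_on with
  | zero => exact ⟨0, zero_smul _ _⟩
  | add x y hx hy =>
    obtain ⟨s, hs⟩ := hx
    obtain ⟨t, ht⟩ := hy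
    exact ⟨s + t, by rw [add_smul, hs, ht]; rfl⟩
  | tmul s c =>
    obtain ⟨c, rfl⟩ : ∃ c', weightVec χ hχ l hl c' = c := ⟨c, rfl⟩
    refine ⟨s * UW0toUW χ (algebraMap K _ c), ?_⟩
    change _ = vermaMk χ hχ l hl s (weightVec χ hχ l hl c)
    rw [vermaGen, smul_vermaMk, mul_one, vermaMk_mul, weightVec_eq_algebraMap_smul _ _ _ _ (c : K)]

/-- The additive map `K_l → K ^ p`, `c ↦ c u_0`. -/
def weightToDensity : WeightModule χ hχ l hl →+ DensityModule χ hχ l hl :=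
  (LinearMap.toSpanSingleton K (Fin p → K) (unit K p 0)).toAddMonoidHom

omit [CharP K p] [Fact p.Prime] in
theorem weightToDensity_apply (c : K) :
    weightToDensity χ hχ l hl (weightVec χ hχ l hl c) = c • unit K p 0 := rfl

/-- The `U_χ(W)`-homomorphism from the reduced Verma module to its model with
`1 ⊗ 1 ↦ u_0`. -/
noncomputable def vermaToDensity : Verma χ hχ l hl →ₗ[UW χ] DensityModule χ hχ l hl :=
  Submodule.liftQ _
    (TensorProduct.AlgebraTensorModule.lift
      (LinearMap.toSpanSingleton (UW χ) (WeightModule χ hχ l hl →ₗ[ℤ] DensityModule χ hχ l hl)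
        (weightToDensity χ hχ l hl).toIntLinearMap)) (by
    rw [balancedRelations, Submodule.span_le]
    rintro _ ⟨s, r, c, rfl⟩
    rw [SetLike.mem_coe, LinearMap.mem_ker, map_sub, sub_eq_zero]
    obtain ⟨c, rfl⟩ : ∃ c', weightVec χ hχ l hl c' = c := ⟨c, rfl⟩
    change (s * UW0toUW χ r) • weightToDensity χ hχ l hl (weightVec χ hχ l hl c) =
      s • weightToDensity χ hχ l hl (r • weightVec χ hχ l hl c)
    rw [mul_smul, smul_weightVec, weightToDensity_apply, weightToDensity_apply, mul_comm, mul_smul,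
      ← densityRep0_unit_zero]
    congr 1
    exact map_smul (densityRep χ hχ l hl (UW0toUW χ r)) c (unit K p 0))

theorem vermaToDensity_smul_vermaGen (s : UW χ) :
    vermaToDensity χ hχ l hl (s • vermaGen χ hχ l hl) = densityRep χ hχ l hl s (unit K p 0) := by
  rw [map_smul, DensityModule.smul_def]
  congr 1
  change (1 : UW χ) • weightToDensity χ hχ l hl (weightVec χ hχ l hl 1) = unit K p 0
  rw [one_smul, weightToDensity_apply, one_smul]

/-- The element `e_i` of `U_χ(W)`. -/
noncomputable abbrev genW (i : ℤ) : UW χ :=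
  ReducedEnveloping.ι p (basisW K p) (basisWpow K p) χ (e K p i)

theorem genW_mul_genW_neg_one (i : ℤ) (h : 0 ≤ i) (h' : i ≤ (p : ℤ) - 2) :
    genW χ i * genW χ (-1) =
      genW χ (-1) * genW χ i + ((-1 - i : ℤ) : K) • genW χ (i - 1) := by
  have hp := (Fact.out : p.Prime).two_le
  have h1 := LieHom.map_lie (ReducedEnveloping.ι p (basisW K p) (basisWpow K p) χ)
    (e K p i) (e K p (-1))
  rw [e_bracket_e (by omega) h' le_rfl (by omega), map_smul,
    LieRing.of_associative_ring_bracket] at h1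
  rw [← sub_eq_iff_eq_add', ← h1]
  rfl

/-- The powers of `e_{-1}` applied to the generator span the reduced Verma module. -/
theorem span_genW_pow_smul_vermaGen :
    Submodule.span K (Set.range fun k : ℕ => genW χ (-1) ^ k • vermaGen χ hχ l hl) = ⊤ := by
  set Q := Submodule.span K (Set.range fun k : ℕ => genW χ (-1) ^ k • vermaGen χ hχ l hl)
  have hp := (Fact.out : p.Prime).two_le
  have hgen (k : ℕ) : genW χ (-1) ^ k • vermaGen χ hχ l hl ∈ Q :=
    Submodule.subset_span ⟨k, rfl⟩
  have hneg (x) (hx : x ∈ Q) : genW χ (-1) • x ∈ Q := by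
    induction hx using Submodule.span_induction with
    | mem x h =>
      obtain ⟨k, rfl⟩ := h
      dsimp only
      rw [smul_smul, ← pow_succ']
      exact hgen _
    | zero => rw [smul_zero]; exact Q.zero_mem
    | add x y _ _ hx hy => rw [smul_add]; exact Q.add_mem hx hy
    | smul c x _ hx => rw [smul_comm]; exact Q.smul_mem c hx
  have hstep (k : ℕ) : ∀ i : ℤ, -1 ≤ i → i ≤ (p : ℤ) - 2 →
      genW χ i • genW χ (-1) ^ k • vermaGen χ hχ l hl ∈ Q := by
    induction k with
    | zero =>
      intro i h h'
      obtain rfl | hi := h.eq_or_lt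
      · exact hneg _ (hgen 0)
      · rw [pow_zero, one_smul]
        have h1 := UW0toUW_smul_vermaGen χ hχ l hl
          (ReducedEnveloping.ι p (basisW0 K p) (basisW0pow K p) (restrictW0 χ)
            (basisW0 K p ⟨i, by omega, h'⟩))
        rw [UW0toUW_ι] at h1
        change genW χ i • _ = _ at h1
        rw [h1]
        simpa using Q.smul_mem _ (hgen 0)
    | succ k ih =>
      intro i h h'
      obtain rfl | hi := h.eq_or_lt
      · exact hneg _ (hgen _)
      · rw [pow_succ', mul_smul, smul_smul, genW_mul_genW_neg_one χ i (by omega) h', add_smul,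
          mul_smul, smul_assoc]
        exact Q.add_mem (hneg _ (ih i h h')) (Q.smul_mem _ (ih (i - 1) (by omega) (by omega)))
  let S : Subalgebra K (UW χ) :=
    { carrier := {s | ∀ x ∈ Q, s • x ∈ Q}
      mul_mem' := fun {a b} ha hb x hx => by rw [mul_smul]; exact ha _ (hb _ hx)
      add_mem' := fun {a b} ha hb x hx => by rw [add_smul]; exact Q.add_mem (ha _ hx) (hb _ hx)
      algebraMap_mem' := fun c x hx => by rw [algebraMap_smul]; exact Q.smul_mem c hx }
  rw [eq_top_iff]
  rintro x -
  obtain ⟨s, rfl⟩ := exists_smul_vermaGen χ hχ l hl x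
  have hs : s ∈ S := by
    refine UW_subalgebra_eq_top χ S (fun i h h' x hx => ?_) s
    induction hx using Submodule.span_induction with
    | mem x hx =>
      obtain ⟨k, rfl⟩ := hx
      exact hstep k i h h'
    | zero => rw [smul_zero]; exact Q.zero_mem
    | add x y _ _ hx hy => rw [smul_add]; exact Q.add_mem hx hy
    | smul c x _ hx => rw [smul_comm]; exact Q.smul_mem c hx
  simpa using hs _ (hgen 0)

theorem genW_neg_one_pow : genW χ (-1) ^ p = algebraMap K (UW χ) (χ (e K p (-1)) ^ p) := by
  have hp := (Fact.out : p.Prime).two_le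
  have h1 := ReducedEnveloping.ι_pow p (basisW K p) (basisWpow K p) χ ⟨-1, le_rfl, by omega⟩
  have h2 : basisWpow K p ⟨-1, le_rfl, by omega⟩ = 0 := if_neg (by norm_num)
  rw [h2, map_zero, zero_add] at h1
  exact h1

/-- The linear map from the model to the reduced Verma module that is inverse to
`vermaToDensity`. -/
noncomputable def densityToVerma : (Fin p → K) →ₗ[K] Verma χ hχ l hl :=
  (Pi.basisFun K (Fin p)).constr K fun k : Fin p =>
    ((-1) ^ (k : ℕ) * ((k : ℕ).factorial : K))⁻¹ • genW χ (-1) ^ (k : ℕ) • vermaGen χ hχ l hl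

theorem densityToVerma_unit (k : Fin p) : densityToVerma χ hχ l hl (unit K p k) =
    ((-1) ^ (k : ℕ) * ((k : ℕ).factorial : K))⁻¹ •
      genW χ (-1) ^ (k : ℕ) • vermaGen χ hχ l hl := by
  rw [unit_eq_basisFun, densityToVerma, Module.Basis.constr_basis]

theorem vermaToDensity_densityToVerma (f : Fin p → K) :
    vermaToDensity χ hχ l hl (densityToVerma χ hχ l hl f) = f := by
  have hp := (Fact.out : p.Prime).two_le
  have h : ((vermaToDensity χ hχ l hl).restrictScalars K).comp (densityToVerma χ hχ l hl) =
      (LinearMap.id : (Fin p → K) →ₗ[K] (Fin p → K)) := by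
    refine (Pi.basisFun K (Fin p)).ext fun k => ?_
    rw [← unit_eq_basisFun, LinearMap.comp_apply, densityToVerma_unit, map_smul,
      LinearMap.restrictScalars_apply, vermaToDensity_smul_vermaGen, map_pow,
      densityRep_ι χ hχ l hl le_rfl (by omega), densityOp_neg_one_pow_unit _ _ _ k.isLt]
    exact inv_smul_smul₀ (neg_one_pow_mul_factorial_ne_zero k.isLt) _
  exact LinearMap.congr_fun h f

theorem densityToVerma_surjective : Function.Surjective (densityToVerma χ hχ l hl) := by
  have hp := (Fact.out : p.Prime).two_le
  rw [← LinearMap.range_eq_top, eq_top_iff, ← span_genW_pow_smul_vermaGen, Submodule.span_le]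
  rintro _ ⟨k, rfl⟩
  have hlt : k % p < p := Nat.mod_lt _ (by omega)
  have h1 := densityToVerma_unit χ hχ l hl ⟨k % p, hlt⟩
  have h2 : genW χ (-1) ^ k • vermaGen χ hχ l hl = (χ (e K p (-1)) ^ p) ^ (k / p) •
      genW χ (-1) ^ (k % p) • vermaGen χ hχ l hl := by
    conv_lhs => rw [← Nat.div_add_mod k p]
    rw [pow_add, pow_mul, genW_neg_one_pow, ← RingHom.map_pow, mul_smul, algebraMap_smul]
  change genW χ (-1) ^ k • vermaGen χ hχ l hl ∈ _
  rw [h2]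
  refine Submodule.smul_mem _ _ ?_
  refine (Submodule.smul_mem_iff _
    (inv_ne_zero (neg_one_pow_mul_factorial_ne_zero (K := K) hlt))).1 ?_
  exact h1 ▸ LinearMap.mem_range_self _ _

/-- The reduced Verma module is isomorphic to its model; in particular its dimension is `p`. -/
noncomputable def vermaEquivDensity : Verma χ hχ l hl ≃ₗ[UW χ] DensityModule χ hχ l hl :=
  LinearEquiv.ofBijective (vermaToDensity χ hχ l hl) (by
    constructor
    · intro x y hxy
      obtain ⟨f, rfl⟩ := densityToVerma_surjective χ hχ l hl x
      obtain ⟨g, rfl⟩ := densityToVerma_surjective χ hχ l hl y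
      rw [vermaToDensity_densityToVerma, vermaToDensity_densityToVerma] at hxy
      rw [hxy]
    · exact fun f => ⟨_, vermaToDensity_densityToVerma χ hχ l hl f⟩)

open CategoryTheory in
/-- The extension space with the reduced Verma module replaced by its model. -/
theorem nonempty_extOne_equiv (l' : K) (hl' : l' ∈ weights χ) :
    Nonempty (ExtOne χ hχ l' l hl' hl ≃ₗ[K]
      Abelian.Ext.{u} (ModuleCat.of (UW0 χ) (WeightModule χ hχ l' hl'))
        (ModuleCat.of (UW0 χ) (DensityModule χ hχ l hl)) 1) := by
  let φ := (ModuleCat.restrictScalars (UW0toUW χ).toRingHom).mapIso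
    (vermaEquivDensity χ hχ l hl).toModuleIso
  let R := (ModuleCat.restrictScalars (UW0toUW χ).toRingHom).obj
    (ModuleCat.of (UW χ) (DensityModule χ hχ l hl))
  let ψ : R ≅ ModuleCat.of (UW0 χ) (DensityModule χ hχ l hl) :=
    LinearEquiv.toModuleIso (X₁ := R)
      ({ AddEquiv.refl (DensityModule χ hχ l hl) with map_smul' := fun _ _ => rfl } :
        R ≃ₗ[UW0 χ] DensityModule χ hχ l hl)
  let θ := φ ≪≫ ψ
  refine ⟨LinearEquiv.ofLinearMap
    (Abelian.Ext.postcompOfLinear (Abelian.Ext.mk₀ θ.hom) K _ (add_zero 1))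
    (Abelian.Ext.postcompOfLinear (Abelian.Ext.mk₀ θ.inv) K _ (add_zero 1)) ?_ ?_⟩
  · refine LinearMap.ext fun x => ?_
    change (x.comp (Abelian.Ext.mk₀ θ.inv) (add_zero 1)).comp (Abelian.Ext.mk₀ θ.hom)
      (add_zero 1) = x
    rw [Abelian.Ext.comp_assoc_of_second_deg_zero, Abelian.Ext.mk₀_comp_mk₀, θ.inv_hom_id,
      Abelian.Ext.comp_mk₀_id]
  · refine LinearMap.ext fun x => ?_
    change (x.comp (Abelian.Ext.mk₀ θ.hom) (add_zero 1)).comp (Abelian.Ext.mk₀ θ.inv)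
      (add_zero 1) = x
    rw [Abelian.Ext.comp_assoc_of_second_deg_zero, Abelian.Ext.mk₀_comp_mk₀, θ.hom_inv_id,
      Abelian.Ext.comp_mk₀_id]

end VermaModel

end Witt

/-! ### Block triangular operators -/

section Triangular

variable {K : Type u} [Field K] {V : Type v} [AddCommGroup V] [Module K V]

/-- The block matrix `(E v; 0 w)` acting on `V × K`. -/
def triangularOp (E : Module.End K V) (v : V) (w : K) : Module.End K (V × K) :=
  LinearMap.prod (E.comp (LinearMap.fst K V K) + (LinearMap.snd K V K).smulRight v)
    (w • LinearMap.snd K V K)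

theorem triangularOp_apply (E : Module.End K V) (v : V) (w : K) (q : V × K) :
    triangularOp E v w q = (E q.1 + q.2 • v, w * q.2) := rfl

theorem triangularOp_mul (E E' : Module.End K V) (v v' : V) (w w' : K) :
    triangularOp E v w * triangularOp E' v' w' =
      triangularOp (E * E') (E v' + w' • v) (w * w') := by
  refine LinearMap.ext fun q => ?_
  simp only [Module.End.mul_apply, triangularOp_apply, map_add, map_smul, smul_add, smul_smul,
    mul_assoc, add_assoc, mul_comm w' q.2]

theorem triangularOp_add (E E' : Module.End K V) (v v' : V) (w w' : K) :
    triangularOp E v w + triangularOp E' v' w' = triangularOp (E + E') (v + v') (w + w') := by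
  refine LinearMap.ext fun q => ?_
  simp only [LinearMap.add_apply, triangularOp_apply, Prod.mk_add_mk, smul_add, add_mul]
  congr 1
  abel

theorem triangularOp_sub (E E' : Module.End K V) (v v' : V) (w w' : K) :
    triangularOp E v w - triangularOp E' v' w' = triangularOp (E - E') (v - v') (w - w') := by
  rw [sub_eq_iff_eq_add, triangularOp_add, sub_add_cancel, sub_add_cancel, sub_add_cancel]

theorem triangularOp_smul (c : K) (E : Module.End K V) (v : V) (w : K) :
    c • triangularOp E v w = triangularOp (c • E) (c • v) (c * w) := by
  refine LinearMap.ext fun q => ?_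
  simp only [LinearMap.smul_apply, triangularOp_apply, Prod.smul_mk, smul_add, smul_smul,
    smul_eq_mul, mul_assoc, mul_comm c q.2]

theorem algebraMap_eq_triangularOp (c : K) :
    algebraMap K (Module.End K (V × K)) c = triangularOp (algebraMap K _ c) 0 c := by
  refine LinearMap.ext fun q => ?_
  simp [triangularOp_apply, Module.algebraMap_end_apply, Prod.smul_def]

theorem triangularOp_zero : triangularOp (0 : Module.End K V) 0 0 = 0 := by
  refine LinearMap.ext fun q => ?_
  simp [triangularOp_apply]

theorem triangularOp_diag_pow (E : Module.End K V) (w : K) (n : ℕ) :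
    triangularOp E 0 w ^ n = triangularOp (E ^ n) 0 (w ^ n) := by
  induction n with
  | zero =>
    rw [pow_zero, pow_zero, pow_zero]
    exact LinearMap.ext fun q => by simp [triangularOp_apply]
  | succ n ih =>
    rw [pow_succ', pow_succ', pow_succ', ih, triangularOp_mul]
    simp

theorem triangularOp_nilpotent_pow (E : Module.End K V) (v : V) (n : ℕ) :
    triangularOp E v 0 ^ (n + 1) = triangularOp (E ^ (n + 1)) ((E ^ n) v) 0 := by
  induction n with
  | zero => simp
  | succ n ih =>
    rw [pow_succ', ih, triangularOp_mul, ← pow_succ', zero_smul, add_zero, zero_mul,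
      ← Module.End.mul_apply, ← pow_succ']

end Triangular

/-! ### Generators of the reduced enveloping algebra of `W_0` -/

namespace Witt

section Cohomology

attribute [local instance] LieRing.ofAssociativeRing

variable {K : Type u} [Field K] {p : ℕ} [CharP K p]

/-- The element `e_i` of `U_χ(W_0)`, zero unless `0 ≤ i ≤ p - 2`. -/
noncomputable def genW0 (χ : Module.Dual K (Witt K p)) (i : ℤ) : UW0 χ :=
  if h : 0 ≤ i ∧ i ≤ (p : ℤ) - 2 then
    ReducedEnveloping.ι p (basisW0 K p) (basisW0pow K p) (restrictW0 χ) (basisW0 K p ⟨i, h⟩)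
  else 0

theorem genW0_of_le (χ : Module.Dual K (Witt K p)) {i : ℤ} (h : (p : ℤ) - 1 ≤ i) :
    genW0 χ i = 0 := dif_neg (by omega)

theorem genW0_commutator (χ : Module.Dual K (Witt K p)) {i j : ℤ} (hi : 0 ≤ i)
    (hi' : i ≤ (p : ℤ) - 2) (hj : 0 ≤ j) (hj' : j ≤ (p : ℤ) - 2) :
    genW0 χ i * genW0 χ j - genW0 χ j * genW0 χ i = ((j - i : ℤ) : K) • genW0 χ (i + j) := by
  have h1 := LieHom.map_lie (ReducedEnveloping.ι p (basisW0 K p) (basisW0pow K p) (restrictW0 χ))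
    (basisW0 K p ⟨i, hi, hi'⟩) (basisW0 K p ⟨j, hj, hj'⟩)
  rw [LieRing.of_associative_ring_bracket] at h1
  rw [genW0, genW0, dif_pos ⟨hi, hi'⟩, dif_pos ⟨hj, hj'⟩, ← h1]
  have h2 : (⁅basisW0 K p ⟨i, hi, hi'⟩, basisW0 K p ⟨j, hj, hj'⟩⁆ : W0 K p) =
      ((j - i : ℤ) : K) • (if h : 0 ≤ i + j ∧ i + j ≤ (p : ℤ) - 2 then
        basisW0 K p ⟨i + j, h⟩ else 0) := by
    apply Subtype.ext
    change ⁅e K p i, e K p j⁆ = _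
    rw [e_bracket_e (by omega) hi' (by omega) hj']
    split_ifs with h
    · rfl
    · have h3 : e K p (i + j) = 0 := by
        funext k
        have := k.isLt
        refine if_neg ?_
        unfold deg
        omega
      rw [h3, smul_zero, smul_zero]
      rfl
  rw [h2, map_smul, genW0]
  split_ifs with h
  · rfl
  · rw [map_zero]

theorem genW0_zero_pow [Fact p.Prime] (χ : Module.Dual K (Witt K p)) :
    genW0 χ 0 ^ p = genW0 χ 0 + algebraMap K (UW0 χ) (χ (e K p 0) ^ p) := by
  have hp := (Fact.out : p.Prime).two_le
  have h1 := ReducedEnveloping.ι_pow p (basisW0 K p) (basisW0pow K p) (restrictW0 χ)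
    ⟨0, le_rfl, by omega⟩
  have h2 : basisW0pow K p ⟨0, le_rfl, by omega⟩ = basisW0 K p ⟨0, le_rfl, by omega⟩ := if_pos rfl
  rw [h2] at h1
  rw [genW0, dif_pos ⟨le_rfl, by omega⟩]
  exact h1

variable [Fact p.Prime] {χ : Module.Dual K (Witt K p)} {hχ : height χ ≤ 1} {l l' : K}
  {hl : l ∈ weights χ} {hl' : l' ∈ weights χ}

theorem characterUW0_genW0 {i : ℤ} (h : 0 ≤ i) :
    characterUW0 χ hχ l hl (genW0 χ i) = if i = 0 then l else 0 := by
  have hp := (Fact.out : p.Prime).two_le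
  by_cases h' : i ≤ (p : ℤ) - 2
  · rw [genW0, dif_pos ⟨h, h'⟩, characterUW0_ι]
  · rw [genW0_of_le χ (by omega), map_zero, if_neg (by omega)]

end Cohomology

end Witt

/-! ### Crossed homomorphisms in coordinates -/

namespace Witt

section CrossedHomCoordinates

attribute [local instance] LieRing.ofAssociativeRing

variable {K : Type u} [Field K] {p : ℕ} [CharP K p] [Fact p.Prime]
  {χ : Module.Dual K (Witt K p)} {hχ : height χ ≤ 1} {l l' : K}
  {hl : l ∈ weights χ} {hl' : l' ∈ weights χ}

/-- The coordinates of an element of the model of the reduced Verma module. -/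
def densityCoord (m : ℤ) : DensityModule χ hχ l hl →ₗ[K] K := coord m

omit [CharP K p] [Fact p.Prime] in
theorem densityCoord_of_le {m : ℤ} (h : (p : ℤ) ≤ m) (y : DensityModule χ hχ l hl) :
    densityCoord m y = 0 := coord_of_le h _

omit [CharP K p] [Fact p.Prime] in
theorem ext_densityCoord {y z : DensityModule χ hχ l hl}
    (h : ∀ m : ℤ, 0 ≤ m → m < p → densityCoord m y = densityCoord m z) : y = z :=
  ext_coord h

/-- The element of the model of the reduced Verma module with prescribed coordinates. -/
def densityMk (χ : Module.Dual K (Witt K p)) (hχ : height χ ≤ 1) (l : K) (hl : l ∈ weights χ)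
    (F : ℤ → K) : DensityModule χ hχ l hl := fun k : Fin p => F k

omit [CharP K p] [Fact p.Prime] in
theorem densityCoord_densityMk (F : ℤ → K) {m : ℤ} (h : 0 ≤ m) (h' : m < p) :
    densityCoord m (densityMk χ hχ l hl F) = F m := coord_mk F h h'

theorem genW0_smul {i : ℤ} (hi : 0 ≤ i) (y : DensityModule χ hχ l hl) :
    genW0 χ i • y = densityOp p (χ (e K p (-1)) ^ p) l i y := by
  have hp := (Fact.out : p.Prime).two_le
  by_cases h : i ≤ (p : ℤ) - 2
  · rw [DensityModule.smul_def', genW0, dif_pos ⟨hi, h⟩, densityRep0_ι]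
  · rw [genW0_of_le χ (by omega), zero_smul, densityOp_eq_zero _ l i (by omega) (by omega)]
    rfl

theorem densityCoord_genW0_smul {i : ℤ} (hi : 0 ≤ i) (y : DensityModule χ hχ l hl) {m : ℤ}
    (h : 0 ≤ m) :
    densityCoord m (genW0 χ i • y) = ((i + 1 : ℤ) * l - m) * densityCoord (m + i) y := by
  rw [genW0_smul hi]
  exact coord_densityOp_of_nonneg _ l hi _ h

theorem isCrossedHom_inner (y : DensityModule χ hχ l hl) :
    ∃ d : UW0 χ →ₗ[K] DensityModule χ hχ l hl, IsCrossedHom (characterUW0 χ hχ l' hl') d ∧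
      ∀ a, d a = a • y - characterUW0 χ hχ l' hl' a • y := by
  refine ⟨(LinearMap.toSpanSingleton (UW0 χ) _ y).restrictScalars K -
    (characterUW0 χ hχ l' hl').toLinearMap.smulRight y, fun a b => ?_, fun a => rfl⟩
  change (a * b) • y - characterUW0 χ hχ l' hl' (a * b) • y =
    a • (b • y - characterUW0 χ hχ l' hl' b • y) +
      characterUW0 χ hχ l' hl' b • (a • y - characterUW0 χ hχ l' hl' a • y)
  rw [map_mul, smul_sub, smul_sub, mul_smul, mul_comm, mul_smul,
    smul_comm a (characterUW0 χ hχ l' hl' b)]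
  abel

/-- A crossed homomorphism is determined by its values at the `e_i`. -/
theorem crossedHom_eq_zero {d : UW0 χ →ₗ[K] DensityModule χ hχ l hl}
    (hd : IsCrossedHom (characterUW0 χ hχ l' hl') d)
    (h : ∀ i : ℤ, 0 ≤ i → i ≤ (p : ℤ) - 2 → d (genW0 χ i) = 0) (a : UW0 χ) : d a = 0 := by
  let S : Subalgebra K (UW0 χ) :=
    { carrier := {a | d a = 0}
      mul_mem' := by
        intro a b ha hb
        rw [Set.mem_ofPred_eq] at *
        rw [hd, ha, hb, smul_zero, smul_zero, add_zero]
      add_mem' := by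
        intro a b ha hb
        rw [Set.mem_ofPred_eq] at *
        rw [map_add, ha, hb, add_zero]
      algebraMap_mem' := by
        intro c
        rw [Set.mem_ofPred_eq, Algebra.algebraMap_eq_smul_one, map_smul, hd.apply_one, smul_zero] }
  refine UW0_subalgebra_eq_top χ S (fun i => ?_) a
  have h1 := h i i.2.1 i.2.2
  rwa [genW0, dif_pos i.2] at h1

/-- The cocycle identity of a crossed homomorphism on `W_0`, in coordinates. -/
theorem densityCoord_cocycle {d : UW0 χ →ₗ[K] DensityModule χ hχ l hl}
    (hd : IsCrossedHom (characterUW0 χ hχ l' hl') d) {i j : ℤ} (hi : 0 ≤ i)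
    (hi' : i ≤ (p : ℤ) - 2) (hj : 0 ≤ j) (hj' : j ≤ (p : ℤ) - 2) {m : ℤ} (hm : 0 ≤ m) :
    ((j - i : ℤ) : K) * densityCoord m (d (genW0 χ (i + j))) =
      ((i + 1 : ℤ) * l - m) * densityCoord (m + i) (d (genW0 χ j)) +
        (if j = 0 then l' else 0) * densityCoord m (d (genW0 χ i)) -
      (((j + 1 : ℤ) * l - m) * densityCoord (m + j) (d (genW0 χ i)) +
        (if i = 0 then l' else 0) * densityCoord m (d (genW0 χ j))) := by
  rw [← smul_eq_mul, ← map_smul, ← map_smul, ← genW0_commutator χ hi hi' hj hj', map_sub, hd, hd,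
    map_sub, map_add, map_add, densityCoord_genW0_smul hi _ hm, densityCoord_genW0_smul hj _ hm,
    map_smul, map_smul, characterUW0_genW0 hi, characterUW0_genW0 hj, smul_eq_mul, smul_eq_mul]

/-- The component of weight `l'` of `d(e_0)` vanishes, by the relation for the `p`-th power
of `e_0`. -/
theorem densityCoord_crossedHom_zero {d : UW0 χ →ₗ[K] DensityModule χ hχ l hl}
    (hd : IsCrossedHom (characterUW0 χ hχ l' hl') d) {r : ℤ} (hr : l - l' = (r : K))
    (hr0 : 0 ≤ r) : densityCoord r (d (genW0 χ 0)) = 0 := by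
  have h1 (n : ℕ) : densityCoord r (d (genW0 χ 0 ^ (n + 1))) =
      ((n + 1 : ℕ) : K) * l' ^ n * densityCoord r (d (genW0 χ 0)) := by
    induction n with
    | zero => simp
    | succ n ih =>
      rw [pow_succ', hd, map_add, densityCoord_genW0_smul le_rfl _ hr0, add_zero, ih, map_smul,
        map_pow, characterUW0_genW0 le_rfl, if_pos rfl, smul_eq_mul, ← hr]
      push_cast
      ring
  have hp := (Fact.out : p.Prime).two_le
  have h2 := h1 (p - 1)
  rw [show p - 1 + 1 = p by omega, CharP.cast_eq_zero K p, zero_mul, zero_mul, genW0_zero_pow χ,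
    map_add, Algebra.algebraMap_eq_smul_one, map_smul, hd.apply_one, smul_zero, add_zero] at h2
  exact h2

omit [Fact p.Prime] in
theorem intCast_ne_zero_of_lt {n : ℤ} (h0 : n ≠ 0) (h1 : -(p : ℤ) < n) (h2 : n < p) :
    (n : K) ≠ 0 := by
  rw [Ne, CharP.intCast_eq_zero_iff K p]
  intro h
  exact h0 (Int.eq_zero_of_abs_lt_dvd h (abs_lt.2 ⟨h1, h2⟩))

/-- Up to an inner one, every crossed homomorphism vanishes at `e_0`, and at `e_1` as soon as
`e_1` does not kill the weight space of weight `l'`. -/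
theorem exists_normalization {d : UW0 χ →ₗ[K] DensityModule χ hχ l hl}
    (hd : IsCrossedHom (characterUW0 χ hχ l' hl') d) {r : ℤ} (hr : l - l' = (r : K))
    (hr1 : 1 ≤ r) (hrp : r < p) (hp : 2 < p) (hx : 2 * l - r + 1 ≠ 0) :
    ∃ y : DensityModule χ hχ l hl,
      d (genW0 χ 0) = genW0 χ 0 • y - characterUW0 χ hχ l' hl' (genW0 χ 0) • y ∧
      d (genW0 χ 1) = genW0 χ 1 • y - characterUW0 χ hχ l' hl' (genW0 χ 1) • y := by
  have hl'r : l' = l - r := by rw [← hr]; ring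
  -- at `m = r` the division by zero gives the value `0`, as the numerator vanishes there
  set y₀ : DensityModule χ hχ l hl :=
    densityMk χ hχ l hl fun m => densityCoord m (d (genW0 χ 0)) / ((r - m : ℤ) : K) with hy₀
  obtain ⟨d₀, hd₀, hd₀'⟩ := isCrossedHom_inner (hl' := hl') y₀
  have hD0 : d (genW0 χ 0) = d₀ (genW0 χ 0) := by
    refine ext_densityCoord fun m hm hm' => ?_
    rw [hd₀', map_sub, densityCoord_genW0_smul le_rfl _ hm, characterUW0_genW0 le_rfl, if_pos rfl,
      map_smul, add_zero, hy₀, densityCoord_densityMk _ hm hm', smul_eq_mul, hl'r]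
    obtain rfl | hne := eq_or_ne m r
    · rw [densityCoord_crossedHom_zero hd hr hm]; simp
    · have := intCast_ne_zero_of_lt (K := K) (p := p) (n := r - m) (by omega) (by omega) (by omega)
      field_simp
      push_cast
      ring
  set d₁ := d - d₀ with hd₁
  have hd₁c : IsCrossedHom (characterUW0 χ hχ l' hl') d₁ := by
    intro a b
    change d (a * b) - d₀ (a * b) = a • (d b - d₀ b) + _ • (d a - d₀ a)
    rw [hd, hd₀, smul_sub, smul_sub]
    abel
  have hd₁0 : d₁ (genW0 χ 0) = 0 := by
    rw [hd₁, LinearMap.sub_apply, hD0, sub_self]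
  -- `d₁(e_1)` has weight `l' + 1`
  have hw (m : ℤ) (hm : 0 ≤ m) (hm' : m < p) (hne : m ≠ r - 1) :
      densityCoord m (d₁ (genW0 χ 1)) = 0 := by
    have h1 := densityCoord_cocycle hd₁c (i := 0) (j := 1) le_rfl (by omega) zero_le_one
      (by omega) hm
    rw [hd₁0, if_neg one_ne_zero, if_pos rfl, zero_add, hl'r, add_zero, map_zero, map_zero] at h1
    have h2 := intCast_ne_zero_of_lt (K := K) (p := p) (n := r - m - 1) (by omega) (by omega)
      (by omega)
    refine (mul_eq_zero.1 (?_ : ((r - m - 1 : ℤ) : K) * _ = 0)).resolve_left h2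
    push_cast at h1 ⊢
    linear_combination -h1
  set y₁ : DensityModule χ hχ l hl := densityMk χ hχ l hl fun m =>
    if m = r then densityCoord (r - 1) (d₁ (genW0 χ 1)) / (2 * l - r + 1) else 0 with hy₁
  have hy₁m (m : ℤ) (hm : 0 ≤ m) (hm' : m < p) : densityCoord m y₁ =
      if m = r then densityCoord (r - 1) (d₁ (genW0 χ 1)) / (2 * l - r + 1) else 0 :=
    densityCoord_densityMk _ hm hm'
  have hy₁0 : genW0 χ 0 • y₁ - characterUW0 χ hχ l' hl' (genW0 χ 0) • y₁ = 0 := by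
    refine ext_densityCoord fun m hm hm' => ?_
    rw [map_sub, densityCoord_genW0_smul le_rfl _ hm, characterUW0_genW0 le_rfl, if_pos rfl,
      map_smul, add_zero, hy₁m m hm hm', map_zero, smul_eq_mul, hl'r]
    split_ifs with h
    · rw [h]; push_cast; ring
    · ring
  have hy₁1 : genW0 χ 1 • y₁ - characterUW0 χ hχ l' hl' (genW0 χ 1) • y₁ = d₁ (genW0 χ 1) := by
    refine ext_densityCoord fun m hm hm' => ?_
    rw [map_sub, densityCoord_genW0_smul zero_le_one _ hm, characterUW0_genW0 zero_le_one,
      if_neg one_ne_zero, zero_smul, map_zero, sub_zero]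
    by_cases h : m = r - 1
    · rw [hy₁m _ (by omega) (by omega), if_pos (by omega), h,
        show (((1 + 1 : ℤ) : K) * l - ((r - 1 : ℤ) : K)) = 2 * l - r + 1 by push_cast; ring,
        mul_div_cancel₀ _ hx]
    · rw [hw m hm hm' h]
      by_cases h2 : m + 1 < p
      · rw [hy₁m _ (by omega) h2, if_neg (by omega), mul_zero]
      · rw [densityCoord_of_le (by omega), mul_zero]
  have key (i : ℤ) : genW0 χ i • (y₀ + y₁) - characterUW0 χ hχ l' hl' (genW0 χ i) • (y₀ + y₁) =
      d₀ (genW0 χ i) +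
        (genW0 χ i • y₁ - characterUW0 χ hχ l' hl' (genW0 χ i) • y₁) := by
    rw [hd₀', smul_add, smul_add]
    abel
  refine ⟨y₀ + y₁, ?_, ?_⟩
  · rw [key, hy₁0, add_zero, hD0]
  · rw [key, hy₁1, hd₁, LinearMap.sub_apply]
    abel

/-- A cocycle on `W_0` that vanishes at `e_0` and `e_1` extends to a crossed homomorphism on
`U_χ(W_0)`. The `p`-th power relation imposes `e_i ^ (p - 1) D(e_i) = 0` for `i ≥ 1`, which could
fail only for `i = 1`. -/
theorem exists_crossedHom_of_cocycle (hp : 2 < p) (D : ℤ → Fin p → K)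
    (h0 : D 0 = 0) (h1 : D 1 = 0) (hlarge : ∀ i, (p : ℤ) - 1 ≤ i → D i = 0)
    (hD : ∀ i j : ℤ, 0 ≤ i → i ≤ (p : ℤ) - 2 → 0 ≤ j → j ≤ (p : ℤ) - 2 →
      (densityOp p (χ (e K p (-1)) ^ p) l i (D j) + (if j = 0 then l' else 0) • D i) -
        (densityOp p (χ (e K p (-1)) ^ p) l j (D i) + (if i = 0 then l' else 0) • D j) =
        ((j - i : ℤ) : K) • D (i + j)) :
    ∃ d : UW0 χ →ₗ[K] DensityModule χ hχ l hl, IsCrossedHom (characterUW0 χ hχ l' hl') d ∧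
      ∀ i : ℤ, 0 ≤ i → i ≤ (p : ℤ) - 2 → ∀ m, densityCoord m (d (genW0 χ i)) = coord m (D i) := by
  set a := χ (e K p (-1)) ^ p
  let T (i : ℤ) : Module.End K ((Fin p → K) × K) :=
    triangularOp (densityOp p a l i) (D i) (if i = 0 then l' else 0)
  have hT0 (i : ℤ) (hi : (p : ℤ) - 1 ≤ i) : T i = 0 := by
    change triangularOp (densityOp p a l i) (D i) _ = 0
    rw [hlarge i hi, densityOp_eq_zero a l i hi (by omega), if_neg (by omega)]
    exact triangularOp_zero
  have hT (i j : ℤ) (hi : 0 ≤ i) (hi' : i ≤ (p : ℤ) - 2) (hj : 0 ≤ j) (hj' : j ≤ (p : ℤ) - 2) :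
      T i * T j - T j * T i = ((j - i : ℤ) : K) • T (i + j) := by
    have h2 := hD i j hi hi' hj hj'
    have h3 := densityOp_commutator (p := p) a l (i := i) (j := j) (by omega) (by omega) (by omega)
    change triangularOp _ _ _ * triangularOp _ _ _ - triangularOp _ _ _ * triangularOp _ _ _ =
      _ • triangularOp _ _ _
    rw [triangularOp_mul, triangularOp_mul, triangularOp_sub, triangularOp_smul, ← h2, h3]
    congr 1
    rw [mul_comm, sub_self]
    split_ifs with h
    · rw [show j - i = 0 by omega]; simp
    · rw [mul_zero]
  let f : W0 K p →ₗ⁅K⁆ Module.End K ((Fin p → K) × K) :=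
    { (linearExtension T) ∘ₗ (W0 K p).toSubmodule.subtype with
      map_lie' := by
        intro x y
        exact linearExtension_lie 0 hT0 (fun i j hi hi' hj hj' _ _ => hT i j hi hi' hj hj')
          x.2 y.2 }
  have hf (i : {i : ℤ // 0 ≤ i ∧ i ≤ (p : ℤ) - 2}) : f (basisW0 K p i) = T i :=
    linearExtension_e T (by omega) i.2.2
  have hpow (i : {i : ℤ // 0 ≤ i ∧ i ≤ (p : ℤ) - 2}) : f (basisW0 K p i) ^ p =
      f (basisW0pow K p i) + algebraMap K _ (restrictW0 χ (basisW0 K p i) ^ p) := by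
    let ι := ReducedEnveloping.ι p (basisW0 K p) (basisW0pow K p) (restrictW0 χ)
    have hrep : densityRep0 χ hχ l hl (ι (basisW0 K p i)) ^ p =
        densityRep0 χ hχ l hl (ι (basisW0pow K p i)) +
          algebraMap K _ (restrictW0 χ (basisW0 K p i) ^ p) := by
      rw [← map_pow, ReducedEnveloping.ι_pow, map_add, AlgHom.commutes]
    have hchar : characterUW0 χ hχ l' hl' (ι (basisW0 K p i)) ^ p =
        characterUW0 χ hχ l' hl' (ι (basisW0pow K p i)) +
          restrictW0 χ (basisW0 K p i) ^ p := by
      rw [← map_pow, ReducedEnveloping.ι_pow, map_add, AlgHom.commutes]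
      rfl
    rw [densityRep0_ι] at hrep
    rw [characterUW0_ι] at hchar
    rw [hf, algebraMap_eq_triangularOp]
    by_cases hi : i.1 = 0
    · have h2 : basisW0pow K p i = basisW0 K p i := if_pos hi
      rw [h2, densityRep0_ι] at hrep
      rw [h2, characterUW0_ι] at hchar
      rw [h2, hf]
      change triangularOp _ (D i) _ ^ p = triangularOp _ (D i) _ + _
      rw [triangularOp_add, hi, h0, triangularOp_diag_pow, add_zero]
      rw [hi] at hrep hchar
      rw [if_pos rfl] at hchar ⊢
      rw [hchar]
      congr 1
    · have h2 : basisW0pow K p i = 0 := if_neg hi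
      rw [h2, map_zero, map_zero, zero_add] at hrep hchar
      rw [h2, map_zero, zero_add]
      change triangularOp _ (D i) (if i.1 = 0 then l' else 0) ^ p = _
      rw [if_neg hi] at hchar ⊢
      have h3 : triangularOp (densityOp p a l i) (D i) 0 ^ p =
          triangularOp (densityOp p a l i ^ p) ((densityOp p a l i ^ (p - 1)) (D i)) 0 := by
        have := triangularOp_nilpotent_pow (densityOp p a l i) (D i) (p - 1)
        rwa [Nat.sub_add_cancel (by omega)] at this
      -- `D 1 = 0`, and for `i ≥ 2` the operator lowers the index by `i (p - 1) ≥ p`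
      have h4 : (densityOp p a l i ^ (p - 1)) (D i) = 0 := by
        by_cases hi1 : i.1 = 1
        · rw [hi1, h1]
          exact map_zero _
        · refine ext_coord fun m hm hm' => ?_
          have hi2 : 2 ≤ i.1 := by have := i.2.1; omega
          rw [coord_densityOp_pow a l i.2.1 (p - 1) (D i) hm (by
            have := mul_le_mul_of_nonneg_left hi2 (Int.natCast_nonneg (p - 1))
            omega)]
          exact (map_zero (coord m)).symm
      rw [h3]
      rw [zero_pow (by omega)] at hchar
      congr 1
  let R : UW0 χ →ₐ[K] Module.End K ((Fin p → K) × K) := ReducedEnveloping.lift f hpow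
  -- the operators `R x` are block triangular; the off-diagonal block is the crossed homomorphism
  let d : UW0 χ →ₗ[K] (Fin p → K) :=
    { toFun x := (R x (0, 1)).1
      map_add' x y := by rw [map_add]; rfl
      map_smul' c x := by rw [map_smul]; rfl }
  have hd (x : UW0 χ) (v : Fin p → K)
      (h : R x = triangularOp (densityRep0 χ hχ l hl x) v
        (characterUW0 χ hχ l' hl' x)) : d x = v := by
    change (R x (0, 1)).1 = v
    rw [h, triangularOp_apply, one_smul, map_zero, zero_add]
  let S : Subalgebra K (UW0 χ) :=
    { carrier := {x | ∃ v, R x = triangularOp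
        (densityRep0 χ hχ l hl x) v (characterUW0 χ hχ l' hl' x)}
      mul_mem' := by
        rintro x y ⟨v, hv⟩ ⟨w, hw⟩
        change ∃ v, R (x * y) = _
        rw [map_mul, hv, hw, triangularOp_mul, ← map_mul, ← map_mul]
        exact ⟨_, rfl⟩
      add_mem' := by
        rintro x y ⟨v, hv⟩ ⟨w, hw⟩
        change ∃ v, R (x + y) = _
        rw [map_add, hv, hw, triangularOp_add, ← map_add, ← map_add]
        exact ⟨_, rfl⟩
      algebraMap_mem' := by
        intro c
        refine ⟨0, ?_⟩
        rw [AlgHom.commutes, AlgHom.commutes, AlgHom.commutes]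
        exact algebraMap_eq_triangularOp c }
  have hgen (i : {i : ℤ // 0 ≤ i ∧ i ≤ (p : ℤ) - 2}) :
      R (ReducedEnveloping.ι p (basisW0 K p) (basisW0pow K p) (restrictW0 χ) (basisW0 K p i)) =
        triangularOp (densityRep0 χ hχ l hl
          (ReducedEnveloping.ι p (basisW0 K p) (basisW0pow K p) (restrictW0 χ) (basisW0 K p i)))
          (D i) (characterUW0 χ hχ l' hl' (ReducedEnveloping.ι p (basisW0 K p) (basisW0pow K p)
            (restrictW0 χ) (basisW0 K p i))) := by
    rw [densityRep0_ι, characterUW0_ι]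
    exact (ReducedEnveloping.lift_ι f hpow _).trans (hf i)
  have hS (x : UW0 χ) : x ∈ S := UW0_subalgebra_eq_top χ S (fun i => ⟨_, hgen i⟩) x
  refine ⟨(d : UW0 χ →ₗ[K] (Fin p → K)), fun x y => ?_, fun i hi hi' m => congrArg (coord m) ?_⟩
  · obtain ⟨v, hv⟩ := hS x
    obtain ⟨w, hw⟩ := hS y
    have h2 : d (x * y) = densityRep0 χ hχ l hl x (d y) + characterUW0 χ hχ l' hl' y • d x := by
      rw [hd x v hv, hd y w hw]
      refine hd _ _ ?_
      rw [map_mul, hv, hw, triangularOp_mul, map_mul, map_mul]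
    exact h2
  · refine hd _ _ ?_
    rw [genW0, dif_pos ⟨hi, hi'⟩]
    exact hgen ⟨i, hi, hi'⟩

end CrossedHomCoordinates

end Witt

/-! ### Reduced cocycles -/

namespace Witt

section ReducedCocycles

variable {K : Type u} [Field K]

/-- The coefficients `c i` of a cocycle on `W_0` with values in the reduced Verma module that
sends `e_i` to `c i • u_{s - i}` and vanishes at `e_0` and `e_1`. The condition `large` expresses
that `e_k = 0` for `k ≥ p - 1`; values `c i` with `i > s` are irrelevant. -/
structure IsReducedCocycle (p : ℕ) (l : K) (s : ℤ) (c : ℤ → K) : Prop where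
  zero : c 0 = 0
  one : c 1 = 0
  large : ∀ k : ℤ, (p : ℤ) - 1 ≤ k → k ≤ s → c k = 0
  rel : ∀ i j : ℤ, 1 ≤ i → i ≤ (p : ℤ) - 2 → 1 ≤ j → j ≤ (p : ℤ) - 2 → i + j ≤ s →
    ((j - i : ℤ) : K) * c (i + j) = ((i + 1 : ℤ) * l - (s - i - j : ℤ)) * c j -
      ((j + 1 : ℤ) * l - (s - i - j : ℤ)) * c i

/-- The integer `s` such that a normalized cocycle sends `e_i` to a multiple of `u_{s - i}`, where
`r` is the residue of `l - l'`. Only the index `r - i` modulo `p` is prescribed. For `r = 1` and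
`i ≥ 2` its representative in `[0, p)` is `p + 1 - i`; for larger `r` it is `r - i` if `i ≤ r`, and
the values at `e_i` with `i > r` turn out to be zero. -/
def cocycleDegree (p r : ℕ) : ℤ := if r = 1 then (p : ℤ) + 1 else r

variable {p : ℕ} {l : K} {s : ℤ} {c : ℤ → K}

theorem IsReducedCocycle.rel_one (hc : IsReducedCocycle p l s c) {j : ℤ} (h1 : 1 ≤ j)
    (hj : j ≤ (p : ℤ) - 2) (hs : 1 + j ≤ s) :
    ((j - 1 : ℤ) : K) * c (1 + j) = (2 * l - s + 1 + j) * c j := by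
  have := hc.rel 1 j le_rfl (by omega) h1 hj hs
  rw [hc.one] at this
  push_cast at this ⊢
  linear_combination this

theorem IsReducedCocycle.apply_three (hc : IsReducedCocycle p l s c) (hp : 3 < p) (hs : 3 ≤ s) :
    c 3 = (2 * l - s + 3) * c 2 := by
  have h := hc.rel_one (j := 2) (by omega) (by omega) (by omega)
  norm_num at h
  linear_combination h

theorem IsReducedCocycle.apply_four (hc : IsReducedCocycle p l s c) (hp : 4 < p) (hs : 4 ≤ s) :
    2 * c 4 = (2 * l - s + 4) * c 3 := by
  have h := hc.rel_one (j := 3) (by omega) (by omega) (by omega)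
  norm_num at h
  linear_combination h

theorem IsReducedCocycle.apply_five (hc : IsReducedCocycle p l s c) (hp : 4 < p) (hs : 5 ≤ s) :
    3 * c 5 = (2 * l - s + 5) * c 4 := by
  by_cases hp5 : p = 5
  · rw [hc.large 5 (by omega) hs, hc.large 4 (by omega) (by omega), mul_zero, mul_zero]
  · have h := hc.rel_one (j := 4) (by omega) (by omega) (by omega)
    norm_num at h
    linear_combination h

/-- The first obstruction: the two expressions for the coefficient of degree `5`, from
`[e_1, e_4]` and from `[e_2, e_3]`, agree. -/
theorem IsReducedCocycle.obstruction_five (hc : IsReducedCocycle p l s c) (hp : 4 < p)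
    (hs : 5 ≤ s) :
    (2 * l - s + 1) * ((2 * l - s) * (2 * l - s + 5) - 6 * l) * c 2 = 0 := by
  have h3 := hc.apply_three (by omega) (by omega)
  have h4 := hc.apply_four hp (by omega)
  have h5 := hc.apply_five hp hs
  have h := hc.rel 2 3 (by omega) (by omega) (by omega) (by omega) (by omega)
  norm_num at h
  rw [h3] at h4 h
  linear_combination 6 * h - 2 * h5 - (2 * l - s + 5) * h4

/-- The obstruction of degree `7`, from `[e_1, e_6]` and `[e_3, e_4]`, when the obstruction of
degree `5` vanishes. -/
theorem IsReducedCocycle.obstruction_seven (hc : IsReducedCocycle p l s c) (hp : 8 < p)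
    (hs : 7 ≤ s) (hl : 6 * l = (2 * l - s) * (2 * l - s + 5)) :
    (2 * l - s) * (2 * l - s + 1) * (2 * l - s + 2) * (2 * l - s - 1) * (2 * l - s + 3) * c 2
      = 0 := by
  have h3 := hc.apply_three (by omega) (by omega)
  have h4 := hc.apply_four (by omega) (by omega)
  have h5 := hc.apply_five (by omega) (by omega)
  have h6 := hc.rel_one (j := 5) (by omega) (by omega) (by omega)
  have h7 := hc.rel_one (j := 6) (by omega) (by omega) (by omega)
  have h := hc.rel 3 4 (by omega) (by omega) (by omega) (by omega) (by omega)
  norm_num at h h6 h7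
  rw [h3] at h4 h
  generalize hx : 2 * l - (s : K) = x at *
  have hs' : (s : K) = 2 * l - x := by rw [← hx]; ring
  rw [hs'] at h
  -- `c 7`, `c 6`, `c 5`, `c 4` are eliminated in turn
  linear_combination 120 * h - 24 * h7 - 6 * (x + 7) * h6 - 2 * (x + 7) * (x + 6) * h5 -
    (x + 7) * (x + 6) * (x + 5) * h4 + 60 * (2 * l + x + 7) * h4 +
    20 * (x + 3) * (x + 1) * c 2 * hl

variable [CharP K p]

theorem natCast_ne_zero_of_lt {n : ℕ} (h0 : 0 < n) (h : n < p) : (n : K) ≠ 0 := by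
  rw [Ne, CharP.cast_eq_zero_iff K p]
  exact Nat.not_dvd_of_pos_of_lt h0 h

theorem cast_cocycleDegree (r : ℕ) : ((cocycleDegree p r : ℤ) : K) = r := by
  unfold cocycleDegree
  split_ifs with h
  · simp [h]
  · simp

/-- Away from the exceptional cases the relations force a cocycle that vanishes at `e_0` and `e_1`
to vanish. -/
theorem IsReducedCocycle.apply_two_eq_zero [Fact p.Prime] (hp : 3 < p) {l' : K} {r : ℕ}
    (hr : residue (l - l') = r) (hr1 : 1 ≤ r) (hrp : r < p) (hx : 2 * l - r + 1 ≠ 0)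
    (hc : IsReducedCocycle p l (cocycleDegree p r) c) (hne : ¬ IsExceptional p l l') :
    c 2 = 0 := by
  have hp4 : p ≠ 4 := by rintro rfl; exact absurd (Fact.out : Nat.Prime 4) (by decide)
  have hp8 : p ≠ 8 := by rintro rfl; exact absurd (Fact.out : Nat.Prime 8) (by decide)
  have hcast : ((cocycleDegree p r : ℤ) : K) = r := cast_cocycleDegree r
  have hpK : (p : K) = 0 := CharP.cast_eq_zero K p
  have n2 : (2 : K) ≠ 0 := by
    exact_mod_cast natCast_ne_zero_of_lt (K := K) (p := p) (n := 2) (by omega) (by omega)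
  have n3 : (3 : K) ≠ 0 := by
    exact_mod_cast natCast_ne_zero_of_lt (K := K) (p := p) (n := 3) (by omega) (by omega)
  have n4 : (4 : K) ≠ 0 := by
    exact_mod_cast natCast_ne_zero_of_lt (K := K) (p := p) (n := 4) (by omega) (by omega)
  by_contra ht
  unfold IsExceptional at hne
  rw [hr] at hne
  simp only [not_or, not_and] at hne
  obtain ⟨e1, ⟨e2, e3⟩, e4, e4', e5, e6⟩ := hne
  have hfive (h5 : 5 ≤ cocycleDegree p r) : 6 * l = (2 * l - r) * (2 * l - r + 5) := by
    have h := hc.obstruction_five (by omega) h5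
    rw [hcast] at h
    have h' := ((mul_eq_zero.1 h).resolve_right ht)
    have h'' := (mul_eq_zero.1 h').resolve_left hx
    linear_combination -h''
  by_cases r1 : r = 1
  · subst r1
    have h := hfive (by unfold cocycleDegree; rw [if_pos rfl]; omega)
    have h2 : 4 * ((l - 1) * (l - ((p : K) - 1))) = 0 := by
      rw [hpK]; push_cast at h; linear_combination -h
    rcases mul_eq_zero.1 ((mul_eq_zero.1 h2).resolve_left n4) with h3 | h3
    · exact (e1 rfl).1 (sub_eq_zero.1 h3)
    · exact (e1 rfl).2 (sub_eq_zero.1 h3)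
  have hdeg : cocycleDegree p r = r := if_neg r1
  rw [hdeg] at hc hfive
  by_cases r4 : r = 4
  · have hp5 : p = 5 := by have := e4 r4; omega
    subst r4
    have h4 := hc.large 4 (by omega) (by omega)
    have h3 := hc.apply_three hp (by omega)
    have h := hc.apply_four (by omega) (by omega)
    rw [h4, h3] at h
    have h5 : (5 : K) = 0 := by rw [hp5] at hpK; exact_mod_cast hpK
    have h' : (2 * 2) * (l * (l - 3)) * c 2 = 0 := by
      push_cast at h
      linear_combination -h - 2 * l * c 2 * h5
    rcases mul_eq_zero.1 ((mul_eq_zero.1 ((mul_eq_zero.1 h').resolve_right ht)).resolve_left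
      (mul_ne_zero n2 n2)) with h6 | h6
    · exact (e4' rfl).1 h6
    · exact (e4' rfl).2 (sub_eq_zero.1 h6)
  have r5 : 5 ≤ r := by omega
  have h6l := hfive (by omega)
  by_cases r5' : r = 5
  · subst r5'
    have h2 : 4 * (l * (l - 4)) = 0 := by push_cast at h6l; linear_combination -h6l
    rcases mul_eq_zero.1 ((mul_eq_zero.1 h2).resolve_left n4) with h3 | h3
    · exact (e5 rfl).1 h3
    · exact (e5 rfl).2 (sub_eq_zero.1 h3)
  have n5 : (5 : K) ≠ 0 := by
    exact_mod_cast natCast_ne_zero_of_lt (K := K) (p := p) (n := 5) (by omega) (by omega)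
  have h3 := hc.apply_three (by omega) (by omega)
  have h4 := hc.apply_four (by omega) (by omega)
  have h5 := hc.apply_five (by omega) (by omega)
  push_cast at h3 h4 h5
  by_cases r6 : r = 6
  · subst r6
    by_cases hp7 : 7 < p
    · refine e6 rfl ⟨2 * l - 5, ?_, by ring⟩ hp7
      push_cast at h6l
      linear_combination -h6l
    · have hp7 : p = 7 := by omega
      -- in characteristic `7` the relation for `[e_1, e_5] = 0` also applies
      have h6 := hc.rel_one (j := 5) (by omega) (by omega) (by omega)
      rw [hc.large (1 + 5) (by omega) (by omega)] at h6
      push_cast at h3 h4 h5 h6 h6l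
      have h8 : 2 * (l * (2 * l - 1) * (2 * l - 2) * (2 * l - 3)) * c 2 = 0 := by
        linear_combination -6 * h6 - 4 * l * h5 - 2 * l * (2 * l - 1) * h4 -
          2 * l * (2 * l - 1) * (2 * l - 2) * h3
      have h9 := (mul_eq_zero.1 ((mul_eq_zero.1 h8).resolve_right ht)).resolve_left n2
      -- the quadratic equation for `l` has no root in common with the product
      have hq : 4 * l ^ 2 - 20 * l + 6 = 0 := by linear_combination -h6l
      rcases mul_eq_zero.1 h9 with h9 | h9
      · rcases mul_eq_zero.1 h9 with h9 | h9
        · rcases mul_eq_zero.1 h9 with h9 | h9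
          · rw [h9] at hq
            exact mul_ne_zero n2 n3 (by linear_combination hq)
          · exact n3 (by linear_combination -hq + (2 * l - 9) * h9)
        · exact mul_ne_zero n2 n5 (by linear_combination (2 * l - 8) * h9 - hq)
      · exact mul_ne_zero n3 n5 (by linear_combination (2 * l - 7) * h9 - hq)
  have h7 := hc.obstruction_seven (by omega) (by omega) (by push_cast; exact h6l)
  push_cast at h7
  have h7' := (mul_eq_zero.1 h7).resolve_right ht
  have rne (q : ℕ) (hq : q < r) : ((r : K) - q) ≠ 0 := by
    have := natCast_ne_zero_of_lt (K := K) (p := p) (n := r - q) (by omega) (by omega)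
    rwa [Nat.cast_sub hq.le] at this
  have hr0 := rne 0 (by omega)
  have hr1 := rne 1 (by omega)
  push_cast at hr0 hr1
  have key : (2 * l - r) * (2 * l - r + 2) = 3 * (r : K) := by linear_combination -h6l
  rcases mul_eq_zero.1 h7' with h8 | h8
  · rcases mul_eq_zero.1 h8 with h8 | h8
    · rcases mul_eq_zero.1 h8 with h8 | h8
      · rcases mul_eq_zero.1 h8 with h8 | h8
        · exact mul_ne_zero n3 hr0 (by linear_combination -key + (2 * l - r + 2) * h8)
        · exact hx h8
      · exact mul_ne_zero n3 hr0 (by linear_combination -key + (2 * l - r) * h8)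
    · exact mul_ne_zero n3 hr1 (by linear_combination -key + (2 * l - r + 3) * h8)
  · exact mul_ne_zero n3 hr1 (by linear_combination -key + (2 * l - r - 1) * h8)

/-- In the exceptional cases there is a cocycle that vanishes at `e_0` and `e_1` but not at
`e_2`. -/
theorem exists_isReducedCocycle [Fact p.Prime] (hp : 3 < p) {l' : K} {r : ℕ}
    (hr : residue (l - l') = r) (hrp : r < p) (he : IsExceptional p l l') :
    ∃ c : ℤ → K, IsReducedCocycle p l (cocycleDegree p r) c ∧ c 2 ≠ 0 := by
  have hp4 : p ≠ 4 := by rintro rfl; exact absurd (Fact.out : Nat.Prime 4) (by decide)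
  have hp6 : p ≠ 6 := by rintro rfl; exact absurd (Fact.out : Nat.Prime 6) (by decide)
  have hpK : (p : K) = 0 := CharP.cast_eq_zero K p
  have n2 : (2 : K) ≠ 0 := by
    exact_mod_cast natCast_ne_zero_of_lt (K := K) (p := p) (n := 2) (by omega) (by omega)
  have n3 : (3 : K) ≠ 0 := by
    exact_mod_cast natCast_ne_zero_of_lt (K := K) (p := p) (n := 3) (by omega) (by omega)
  unfold IsExceptional at he
  rw [hr] at he
  by_cases r1 : r = 1
  · subst r1
    have hl : l = 1 ∨ l = -1 := by
      rw [hpK, zero_sub] at he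
      rcases he with he | he | he | he | he | he
      · exact he.2
      all_goals omega
    have hdeg : cocycleDegree p 1 = (p : ℤ) + 1 := if_pos rfl
    rw [hdeg]
    rcases hl with rfl | rfl
    · refine ⟨fun i => (i : K) ^ 3 - i, ⟨by simp, by simp, fun k h1 h2 => ?_,
        fun i j _ _ _ _ _ => ?_⟩, ?_⟩
      · obtain ⟨q, hq⟩ : ∃ q : ℤ, k = p + q := ⟨k - p, by ring⟩
        have hq' : q = -1 ∨ q = 0 ∨ q = 1 := by omega
        rw [hq]
        push_cast
        rw [hpK]
        rcases hq' with rfl | rfl | rfl <;> norm_num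
      · push_cast
        rw [hpK]
        ring
      · have : ((2 : ℤ) : K) ^ 3 - ((2 : ℤ) : K) = 2 * 3 := by push_cast; ring
        exact this.trans_ne (mul_ne_zero n2 n3)
    · refine ⟨fun i => if i = 2 then 1 else 0, ⟨by simp, by simp, fun k h1 h2 => ?_,
        fun i j hi hi' hj hj' hs => ?_⟩, by simp⟩
      · exact if_neg (by omega)
      · by_cases hi2 : i = 2
        · by_cases hj2 : j = 2
          · rw [hi2, hj2]; simp
          · rw [if_neg (by omega), if_neg hj2, if_pos hi2, hi2]
            push_cast
            rw [hpK]
            ring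
        · by_cases hj2 : j = 2
          · rw [if_neg (by omega), if_pos hj2, if_neg hi2, hj2]
            push_cast
            rw [hpK]
            ring
          · rw [if_neg hj2, if_neg hi2]
            by_cases hij : i + j = 2
            · rw [show j - i = 0 by omega]; simp
            · rw [if_neg hij]; simp
  have hdeg : cocycleDegree p r = r := if_neg r1
  rw [hdeg]
  have hr2 : 2 ≤ r := by omega
  have hr6 : r ≤ 6 := by omega
  have h7 : r = 6 → 7 < p := fun h => by
    rcases he with he | he | he | he | he | he <;> omega
  -- the obstructions in degrees `5` and `6` are multiples of this relation
  have h6l : 5 ≤ r → 6 * l = (2 * l - r) * (2 * l - r + 5) := by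
    intro h5
    rcases he with he | he | he | he | he | he
    · omega
    · omega
    · omega
    · omega
    · rw [he.1]
      push_cast
      rcases he.2 with h | h <;> rw [h] <;> ring
    · rw [he.1]
      obtain ⟨s, hs, hls⟩ := he.2.1
      push_cast
      have h1 : (2 * l - 5) ^ 2 = 19 := by rw [← hs, hls]; ring
      linear_combination -h1
  generalize hx : 2 * l - (r : K) = x at h6l
  have hrx : (r : K) = 2 * l - x := by rw [← hx]; ring
  let c : ℤ → K := fun i =>
    if i = 2 then 24 else if i = 3 then 24 * (x + 3) else
    if i = 4 then 12 * (x + 3) * (x + 4) else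
    if i = 5 then 4 * (x + 3) * (x + 4) * (x + 5) else
    if i = 6 then (x + 3) * (x + 4) * (x + 5) * (x + 6) else 0
  have c1 : c 1 = 0 := rfl
  have c2 : c 2 = 24 := rfl
  have c3 : c 3 = 24 * (x + 3) := rfl
  have c4 : c 4 = 12 * (x + 3) * (x + 4) := rfl
  have c5 : c 5 = 4 * (x + 3) * (x + 4) * (x + 5) := rfl
  have c6 : c 6 = (x + 3) * (x + 4) * (x + 5) * (x + 6) := rfl
  have hrel (i j : ℤ) (hi : 1 ≤ i) (hij : i < j) (hs : i + j ≤ r) :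
      ((j - i : ℤ) : K) * c (i + j) = ((i + 1 : ℤ) * l - (r - i - j : ℤ)) * c j -
        ((j + 1 : ℤ) * l - (r - i - j : ℤ)) * c i := by
    have h : (i = 1 ∧ j = 2) ∨ (i = 1 ∧ j = 3) ∨ (i = 1 ∧ j = 4) ∨ (i = 1 ∧ j = 5) ∨
        (i = 2 ∧ j = 3) ∨ (i = 2 ∧ j = 4) := by omega
    push_cast
    rw [hrx]
    rcases h with ⟨rfl, rfl⟩ | ⟨rfl, rfl⟩ | ⟨rfl, rfl⟩ | ⟨rfl, rfl⟩ | ⟨rfl, rfl⟩ | ⟨rfl, rfl⟩ <;>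
      norm_num only [c1, c2, c3, c4, c5, c6]
    · ring
    · ring
    · ring
    · ring
    · linear_combination (-4 * (x + 1)) * h6l (by omega)
    · linear_combination (-2 * (x + 1) * (x + 6)) * h6l (by omega)
  refine ⟨c, ⟨rfl, rfl, fun k h1 h2 => ?_, fun i j hi _ hj _ hs => ?_⟩, ?_⟩
  · -- only `p = 5`, `r = k = 4` is possible
    have hk : k = 4 ∧ p = 5 ∧ r = 4 := by omega
    obtain ⟨rfl, hp5, hr4⟩ := hk
    have h5 : (5 : K) = 0 := by rw [hp5] at hpK; exact_mod_cast hpK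
    have hl : l = 0 ∨ l = 3 := by
      rcases he with he | he | he | he | he | he
      · omega
      · omega
      · omega
      · exact he.2
      · omega
      · omega
    rw [c4, ← hx, hr4]
    push_cast
    rcases hl with h | h <;> rw [h]
    · ring
    · linear_combination 12 * 6 * h5
  · rcases lt_trichotomy i j with h | h | h
    · exact hrel i j hi h hs
    · rw [h]; simp
    · have := hrel j i hj h (by omega)
      rw [add_comm j i] at this
      push_cast at this ⊢
      linear_combination -this
  · rw [c2, show (24 : K) = 2 * 2 * 2 * 3 by norm_num]
    exact mul_ne_zero (mul_ne_zero (mul_ne_zero n2 n2) n2) n3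

end ReducedCocycles

end Witt

/-! ### Classification -/

namespace Witt

section Classification

variable {K : Type u} [Field K] {p : ℕ} [CharP K p] [Fact p.Prime]
  {χ : Module.Dual K (Witt K p)} {hχ : height χ ≤ 1} {l l' : K}
  {hl : l ∈ weights χ} {hl' : l' ∈ weights χ}

omit [CharP K p] [Fact p.Prime] in
theorem cocycleDegree_le {r : ℕ} (hrp : r < p) : cocycleDegree p r ≤ (p : ℤ) + 1 := by
  unfold cocycleDegree
  split_ifs <;> omega

/-- A crossed homomorphism that vanishes at `e_0` and `e_1` is given by a reduced cocycle, and is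
determined by the value at `e_2`. -/
theorem crossedHom_isReducedCocycle (hp : 3 < p) {r : ℕ} (hr : l - l' = r) (hr1 : 1 ≤ r)
    (hrp : r < p) {d : UW0 χ →ₗ[K] DensityModule χ hχ l hl}
    (hd : IsCrossedHom (characterUW0 χ hχ l' hl') d) (h0 : d (genW0 χ 0) = 0)
    (h1 : d (genW0 χ 1) = 0) :
    IsReducedCocycle p l (cocycleDegree p r)
      (fun i => densityCoord (cocycleDegree p r - i) (d (genW0 χ i))) ∧
    (densityCoord (cocycleDegree p r - 2) (d (genW0 χ 2)) = 0 → ∀ a, d a = 0) := by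
  set s := cocycleDegree p r with hs
  have hl'r : l' = l - r := by rw [← hr]; ring
  refine ⟨⟨?_, ?_, fun k hk _ => ?_, fun i j hi hi' hj hj' hij => ?_⟩, fun h2 => ?_⟩
  · simp [h0]
  · simp [h1]
  · simp [genW0_of_le χ hk]
  · have h := densityCoord_cocycle hd (i := i) (j := j) (by omega) hi' (by omega) hj'
      (m := s - i - j) (by omega)
    rw [if_neg (by omega), if_neg (by omega), zero_mul, zero_mul, add_zero, add_zero,
      show s - i - j + i = s - j by ring, show s - i - j + j = s - i by ring] at h
    rw [show s - (i + j) = s - i - j by ring]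
    exact h
  · have hD2 : d (genW0 χ 2) = 0 := by
      refine ext_densityCoord fun m hm hm' => ?_
      rw [map_zero]
      by_cases hms : m = s - 2
      · rw [hms, h2]
      -- `d(e_2)` has weight `l' + 2`
      have h := densityCoord_cocycle hd (i := 0) (j := 2) le_rfl (by omega) (by omega)
        (by omega) hm
      rw [h0, if_neg two_ne_zero, if_pos rfl, zero_add, hl'r, add_zero, map_zero, map_zero] at h
      have hne : ((r - m - 2 : ℤ) : K) ≠ 0 := by
        unfold cocycleDegree at hs
        by_cases h1 : r = 1
        · rw [if_pos h1] at hs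
          exact intCast_ne_zero_of_lt (by omega) (by omega) (by omega)
        · rw [if_neg h1] at hs
          exact intCast_ne_zero_of_lt (by omega) (by omega) (by omega)
      refine (mul_eq_zero.1 (?_ : ((r - m - 2 : ℤ) : K) * _ = 0)).resolve_left hne
      push_cast at h ⊢
      linear_combination -h
    have hD (n : ℕ) : d (genW0 χ (n + 2)) = 0 := by
      induction n with
      | zero => simpa using hD2
      | succ n ih =>
        by_cases hn : (n : ℤ) + 2 ≤ (p : ℤ) - 3
        · refine ext_densityCoord fun m hm hm' => ?_
          have h := densityCoord_cocycle hd (i := 1) (j := n + 2) (by omega) (by omega)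
            (by omega) (by omega) hm
          rw [h1, ih] at h
          have hne : ((n + 1 : ℕ) : K) ≠ 0 := natCast_ne_zero_of_lt (p := p) (by omega) (by omega)
          rw [map_zero]
          refine (mul_eq_zero.1 (?_ : ((n + 1 : ℕ) : K) * _ = 0)).resolve_left hne
          rw [show ((n + 1 : ℕ) : ℤ) + 2 = 1 + (n + 2) by push_cast; ring]
          simp only [map_zero, mul_zero, add_zero, sub_zero] at h
          push_cast at h ⊢
          linear_combination h
        · rw [genW0_of_le χ (by push_cast; omega), map_zero]
    refine crossedHom_eq_zero hd fun i hi hi' => ?_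
    obtain rfl | hi0 := eq_or_ne i 0
    · exact h0
    obtain rfl | hi1 := eq_or_ne i 1
    · exact h1
    have := hD (i - 2).toNat
    rwa [show ((i - 2).toNat : ℤ) + 2 = i by omega] at this

/-- Every reduced cocycle comes from a crossed homomorphism that vanishes at `e_0` and `e_1`. -/
theorem exists_crossedHom_of_isReducedCocycle (hp : 3 < p) {r : ℕ} (hr : l - l' = r)
    (hrp : r < p) {c : ℤ → K} (hc : IsReducedCocycle p l (cocycleDegree p r) c) :
    ∃ d : UW0 χ →ₗ[K] DensityModule χ hχ l hl, IsCrossedHom (characterUW0 χ hχ l' hl') d ∧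
      d (genW0 χ 0) = 0 ∧ d (genW0 χ 1) = 0 ∧
      (2 ≤ cocycleDegree p r →
        densityCoord (cocycleDegree p r - 2) (d (genW0 χ 2)) = c 2) := by
  set s := cocycleDegree p r with hs
  have hsp : s ≤ (p : ℤ) + 1 := cocycleDegree_le hrp
  have hsK : (s : K) = r := cast_cocycleDegree r
  have hl'r : l' = l - r := by rw [← hr]; ring
  let D (i : ℤ) : Fin p → K := fun k => if (k : ℤ) + i = s then c i else 0
  have hDc (i : ℤ) (hi : 0 ≤ i) (m : ℤ) (hm : 0 ≤ m) :
      coord m (D i) = if m + i = s then c i else 0 := by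
    by_cases hm' : m < p
    · exact coord_mk (fun m => if m + i = s then c i else 0) hm hm'
    · rw [coord_of_le (by omega)]
      split_ifs with h
      · -- `m ≥ p` and `m + i = s ≤ p + 1`
        have hi' : i = 0 ∨ i = 1 := by omega
        rcases hi' with rfl | rfl
        · exact hc.zero.symm
        · exact hc.one.symm
      · rfl
  have hD0 : D 0 = 0 := by
    funext k
    change (if (k : ℤ) + 0 = s then c 0 else 0) = 0
    rw [hc.zero, ite_self]
  have hD1 : D 1 = 0 := by
    funext k
    change (if (k : ℤ) + 1 = s then c 1 else 0) = 0
    rw [hc.one, ite_self]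
  have hlarge (i : ℤ) (hi : (p : ℤ) - 1 ≤ i) : D i = 0 := by
    funext k
    change (if (k : ℤ) + i = s then c i else 0) = 0
    split_ifs with h
    · exact hc.large i hi (by omega)
    · rfl
  obtain ⟨d, hd, hdD⟩ := exists_crossedHom_of_cocycle (χ := χ) (hχ := hχ) (l := l) (hl := hl)
    (l' := l') (hl' := hl') (by omega) D hD0 hD1 hlarge (by
      intro i j hi hi' hj hj'
      refine ext_coord fun m hm hm' => ?_
      rw [map_sub, map_add, map_add, map_smul, map_smul, map_smul,
        coord_densityOp_of_nonneg _ l hi _ hm, coord_densityOp_of_nonneg _ l hj _ hm,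
        hDc j hj (m + i) (by omega), hDc i hi (m + j) (by omega), hDc i hi m hm, hDc j hj m hm,
        hDc (i + j) (by omega) m hm, smul_eq_mul, smul_eq_mul, smul_eq_mul]
      -- for `i = 0` or `j = 0` the identity says that `D` is homogeneous
      obtain rfl | hi0 := eq_or_ne i 0
      · simp only [hc.zero, ite_self, zero_add, add_zero, if_true, mul_zero]
        split_ifs with h
        · rw [hl'r, show m = s - j by omega, Int.cast_sub s, hsK]
          push_cast
          ring
        · ring
      obtain rfl | hj0 := eq_or_ne j 0
      · simp only [hc.zero, ite_self, zero_add, add_zero, if_true, mul_zero]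
        split_ifs with h
        · rw [hl'r, show m = s - i by omega, Int.cast_sub s, hsK]
          push_cast
          ring
        · ring
      rw [if_neg hi0, if_neg hj0, zero_mul, zero_mul, add_zero, add_zero,
        show m + i + j = m + (i + j) by ring, show m + j + i = m + (i + j) by ring]
      split_ifs with h
      · rw [hc.rel i j (by omega) hi' (by omega) hj' (by omega), show s - i - j = m by omega]
      · ring)
  refine ⟨d, hd, ?_, ?_, fun hs2 => ?_⟩
  · refine ext_densityCoord fun m _ _ => ?_
    rw [hdD 0 le_rfl (by omega), hD0, map_zero, map_zero]
  · refine ext_densityCoord fun m _ _ => ?_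
    rw [hdD 1 zero_le_one (by omega), hD1, map_zero, map_zero]
  · rw [hdD 2 (by omega) (by omega), hDc 2 (by omega) _ (by omega), if_pos (by omega)]

/-- The residue of the difference of two weights. -/
theorem residue_spec (hl : l ∈ weights χ) (hl' : l' ∈ weights χ) :
    ((residue (l - l') : ℕ) : K) = l - l' ∧ residue (l - l') < p := by
  have hp := (Fact.out : p.Prime).pos
  have h1 : (l - l') ^ p = l - l' := by
    have h2 : l ^ p - l = l' ^ p - l' := Eq.trans hl (Eq.symm hl')
    rw [sub_pow_char]
    linear_combination h2
  obtain ⟨n, hn⟩ := (mem_bot_iff_intCast p K).1 ((Subfield.mem_bot_iff_pow_eq_self K p).2 h1)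
  have h0 : 0 ≤ n % p := Int.emod_nonneg _ (by omega)
  have hlt : n % p < p := Int.emod_lt_of_pos _ (by omega)
  have hmem : (n % p).toNat ∈ {q : ℕ | (q : K) = l - l'} := by
    change (((n % p).toNat : ℕ) : K) = l - l'
    have h3 : (((n % p).toNat : ℕ) : K) = (((n % p).toNat : ℤ) : K) := by push_cast; rfl
    rw [h3, Int.toNat_of_nonneg h0, ← hn]
    conv_rhs => rw [← Int.emod_add_mul_ediv n p]
    push_cast
    rw [CharP.cast_eq_zero K p, zero_mul, add_zero]
  refine ⟨Nat.sInf_mem ⟨_, hmem⟩, lt_of_le_of_lt (Nat.sInf_le hmem) (by omega)⟩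

end Classification

end Witt

open Witt in
theorem mainTheorem3 (p : ℕ) [Fact p.Prime] (hp : 3 < p) (K : Type u) [Field K] [IsAlgClosed K]
    [CharP K p] (χ : Module.Dual K (Witt K p)) (hχ : Witt.height χ ≤ 1) (l l' : K)
    (hl : l ∈ Witt.weights χ) (hl' : l' ∈ Witt.weights χ) (hΘ : (l, l') ∉ Witt.Theta χ)
    (hsum : l + l' ≠ (p : K) - 1) :
    (Witt.IsExceptional p l l' → Nonempty (Witt.ExtOne χ hχ l' l hl' hl ≃ₗ[K] K)) ∧
      (¬ Witt.IsExceptional p l l' → Subsingleton (Witt.ExtOne χ hχ l' l hl' hl)) := by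
  obtain ⟨φ⟩ := nonempty_extOne_equiv χ hχ l hl l' hl'
  obtain ⟨hr, hrp⟩ := residue_spec hl hl'
  obtain ⟨r, hres⟩ : ∃ r, residue (l - l') = r := ⟨_, rfl⟩
  rw [hres] at hr hrp
  have hpK : (p : K) = 0 := CharP.cast_eq_zero K p
  have hr1 : 1 ≤ r := by
    rw [Nat.one_le_iff_ne_zero]
    rintro rfl
    refine hΘ (Or.inr ⟨l, hl, ?_⟩)
    rw [Nat.cast_zero] at hr
    rw [sub_eq_zero.1 hr.symm]
  -- the weights `l` with `2 l - r + 1 = 0` are those with `l + l' = -1`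
  have hx : 2 * l - r + 1 ≠ 0 := by
    intro h
    apply hsum
    rw [hpK]
    linear_combination h + hr
  have hx' : 2 * l - ((r : ℤ) : K) + 1 ≠ 0 := by rwa [Int.cast_natCast]
  have hr' : l - l' = ((r : ℤ) : K) := by rw [Int.cast_natCast, hr]
  -- the module `K_{l'}` as a quotient of `U_χ(W_0)`
  let ε := characterUW0 χ hχ l' hl'
  let g : UW0 χ →ₗ[UW0 χ] WeightModule χ hχ l' hl' :=
    LinearMap.toSpanSingleton _ _ (weightVec χ hχ l' hl' 1)
  have hgε (a : UW0 χ) : g a = weightVec χ hχ l' hl' (ε a) := by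
    change a • weightVec χ hχ l' hl' 1 = _
    rw [smul_weightVec, mul_one]
  have hg : Function.Surjective g := by
    intro c
    obtain ⟨c, rfl⟩ : ∃ c', weightVec χ hχ l' hl' c' = c := ⟨c, rfl⟩
    exact ⟨algebraMap K _ c, by rw [hgε]; exact congrArg _ (ε.commutes c)⟩
  have hker (a : UW0 χ) : g a = 0 ↔ ε a = 0 := by rw [hgε]; rfl
  have hnorm (d : UW0 χ →ₗ[K] DensityModule χ hχ l hl) (hd : IsCrossedHom ε d) :
      ∃ (y : DensityModule χ hχ l hl) (d' : UW0 χ →ₗ[K] DensityModule χ hχ l hl),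
        IsCrossedHom ε d' ∧ d' (genW0 χ 0) = 0 ∧ d' (genW0 χ 1) = 0 ∧
        ∀ a, d a = d' a + (a • y - ε a • y) := by
    obtain ⟨y, h0, h1⟩ := exists_normalization hd hr' (by omega) (by omega) (by omega) hx'
    obtain ⟨dy, hdy, hdy'⟩ := isCrossedHom_inner (hl' := hl') y
    refine ⟨y, d - dy, fun a b => ?_, ?_, ?_, fun a => ?_⟩
    · change d (a * b) - dy (a * b) = a • (d b - dy b) + _ • (d a - dy a)
      rw [hd, hdy, smul_sub, smul_sub]
      abel
    · rw [LinearMap.sub_apply, h0, hdy', sub_self]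
    · rw [LinearMap.sub_apply, h1, hdy', sub_self]
    · rw [LinearMap.sub_apply, hdy']
      abel
  have hs2 : 2 ≤ cocycleDegree p r := by
    unfold cocycleDegree
    split_ifs <;> omega
  constructor
  · intro he
    obtain ⟨c, hc, hc2⟩ := exists_isReducedCocycle hp hres hrp he
    obtain ⟨d₀, hd₀, h00, h01, h02⟩ := exists_crossedHom_of_isReducedCocycle (χ := χ) (hχ := hχ)
      (hl := hl) (hl' := hl') hp hr.symm hrp hc
    replace h02 := h02 hs2
    suffices h : Nonempty (_ ≃ₗ[K] K) from ⟨φ.trans h.some⟩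
    refine nonempty_ext_equiv_of_crossedHom ε g hg hker d₀ hd₀ ?_ ?_
    · rintro ⟨y, hy⟩
      -- `y` is killed by `e_0 - l'` and `e_1`, hence zero
      have hy0 (m : ℤ) (hm : 0 ≤ m) : ((r - m : ℤ) : K) * densityCoord m y = 0 := by
        have h := congrArg (densityCoord m) (hy (genW0 χ 0))
        rw [h00, map_zero, map_sub, densityCoord_genW0_smul le_rfl _ hm, map_smul,
          characterUW0_genW0 le_rfl, if_pos rfl, smul_eq_mul, add_zero] at h
        push_cast at h ⊢
        rw [hr]
        linear_combination -h
      have hyr : densityCoord r y = 0 := by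
        have h := congrArg (densityCoord (r - 1)) (hy (genW0 χ 1))
        rw [h01, map_zero, map_sub, densityCoord_genW0_smul zero_le_one _ (by omega), map_smul,
          characterUW0_genW0 zero_le_one, if_neg one_ne_zero, zero_smul, sub_zero,
          sub_add_cancel] at h
        refine (mul_eq_zero.1 h.symm).resolve_left ?_
        push_cast
        intro h'
        exact hx (by linear_combination h')
      have hy00 : y = 0 := by
        refine ext_densityCoord fun m hm hm' => ?_
        rw [map_zero]
        obtain rfl | hne := eq_or_ne m r
        · exact hyr
        · exact (mul_eq_zero.1 (hy0 m hm)).resolve_left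
            (intCast_ne_zero_of_lt (by omega) (by omega) (by omega))
      rw [hy, hy00, smul_zero, smul_zero, sub_zero, map_zero] at h02
      exact hc2 h02.symm
    · intro d hd
      obtain ⟨y, d', hd', h0, h1, hdd'⟩ := hnorm d hd
      set t := densityCoord (cocycleDegree p r - 2) (d' (genW0 χ 2)) / c 2 with ht
      refine ⟨t, y, fun a => ?_⟩
      have hcr : IsCrossedHom ε (d' - t • d₀) := by
        intro a b
        change d' (a * b) - t • d₀ (a * b) = a • (d' b - t • d₀ b) + _ • (d' a - t • d₀ a)
        rw [hd', hd₀, smul_sub, smul_sub, smul_add, smul_comm t a, smul_comm t (ε b)]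
        abel
      have hz := (crossedHom_isReducedCocycle hp hr.symm hr1 hrp hcr
        (by rw [LinearMap.sub_apply, LinearMap.smul_apply, h0, h00, smul_zero, sub_zero])
        (by rw [LinearMap.sub_apply, LinearMap.smul_apply, h1, h01, smul_zero, sub_zero])).2
        (by rw [LinearMap.sub_apply, LinearMap.smul_apply, map_sub, map_smul, h02, smul_eq_mul,
              ht, div_mul_cancel₀ _ hc2, sub_self]) a
      rw [LinearMap.sub_apply, LinearMap.smul_apply, sub_eq_zero] at hz
      rw [hdd', hz]
  · intro hne
    suffices h : Subsingleton (CategoryTheory.Abelian.Ext.{u}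
        (ModuleCat.of (UW0 χ) (WeightModule χ hχ l' hl'))
        (ModuleCat.of (UW0 χ) (DensityModule χ hχ l hl)) 1) from φ.toEquiv.subsingleton
    refine subsingleton_ext_of_crossedHom ε g hg hker fun d hd => ?_
    obtain ⟨y, d', hd', h0, h1, hdd'⟩ := hnorm d hd
    obtain ⟨hc, hz⟩ := crossedHom_isReducedCocycle hp hr.symm hr1 hrp hd' h0 h1
    refine ⟨y, fun a => ?_⟩
    rw [hdd', hz (hc.apply_two_eq_zero hp hres hr1 hrp hx hne) a, zero_add]
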